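/- A rooted planar map (a map, for short) is a finite connected graph with at least one edge (loops and multiple edges are allowed), embedded in the sphere, with a marked oriented edge, the root edge; maps are considered up to orientation-preserving homeomorphism, so that a map is the same thing as its rotation system. The starting point of the root edge is the root vertex. A planted plane tree is a map with a single face. A map with a simple boundary of size $n$ and $f$ internal faces is a map with $f+1$ faces such that the face on the left of the root edge (the external face) has $n$ oriented edges on its contour, whose starting points are pairwise distinct. A submap is what remains of a map when edges and vertices are suppressed, with the induced cyclic orders around the vertices. Let $f\ge 0$ and $m_1,m_2\ge 1$ be integers. Let $\mathcal T_{m_2}$ be the set of planted plane trees with $m_2$ edges, let $\mathcal S_{f,n}$ be the set of maps with a simple boundary of size $n$ and $f$ internal faces, and let $\mathcal D_{f,m_1,m_2}$ be the set of tree-decorated maps with a simple boundary: pairs $(\mathfrak m,\mathfrak t)$, where $\mathfrak m\in\mathcal S_{f,m_1}$ and $\mathfrak t$ is an unrooted plane tree with $m_2$ edges that is a submap of $\mathfrak m$ and whose only vertex on the boundary of $\mathfrak m$ is the root vertex of $\mathfrak m$ (pairs are considered up to isomorphisms of $\mathfrak m$ that match the trees). **Proposition.** Gluing is a bijection $$\mathcal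 T_{m_2}\times \mathcal S_{f,\,m_1+2m_2}\longrightarrow \mathcal D_{f,m_1,m_2}.$$ Here the gluing of $\mathfrak t'\in\mathcal T_{m_2}$ to $\mathfrak b\in\mathcal S_{f,m_1+2m_2}$ is defined as follows. Let $t_0,\dots,t_{2m_2-1}$ be the contour of $\mathfrak t'$, walked from the root edge $t_0$ with the face on the left, and let $c_0,\dots,c_{2m_2-1}$ be the first $2m_2$ oriented edges met when one walks along the boundary of $\mathfrak b$ from its root vertex with the interior of $\mathfrak b$ on the left. Whenever $t_i$ and $t_k$ are the two orientations of one edge of $\mathfrak t'$, the oriented edge $c_i$ is identified with the reverse of $c_k$; nothing else is identified. The internal faces of $\mathfrak b$ and its root edge are kept, the $m_1$ boundary edges that are not glued form, in their order, the boundary of the new map $\mathfrak m$, and the decorating tree $\mathfrak t$ is the image of the $c_i$; it is a copy of the plane tree $\mathfrak t'$, with $c_i$ in the place of $t_i$. -/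

import Mathlib

/-- A rooted planar map, encoded by its oriented edges (`Dart`) and its rotation system.
`rot d` is the oriented edge that follows `d` in the clockwise order among the oriented edges
with the same starting point as `d`, and `inv d` is `d` with the opposite orientation.
Vertices, edges and faces are the cycles of `rot`, `inv` and `rot * inv`; the graph is connected
and Euler's relation says that it is drawn on the sphere. -/
structure RootedMap where
  Dart : Type
  finite_dart : Finite Dart
  rot : Equiv.Perm Dart
  inv : Equiv.Perm Dart
  inv_inv : ∀ d, inv (inv d) = d
  inv_ne : ∀ d, inv d ≠ d
  /-- the root edge; its starting point is the root vertex -/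
  root : Dart
  connected : ∀ d d' : Dart, ∃ g ∈ Subgroup.closure ({rot, inv} : Set (Equiv.Perm Dart)), g d = d'
  planar : Nat.card (Quotient (Equiv.Perm.SameCycle.setoid rot))
      + Nat.card (Quotient (Equiv.Perm.SameCycle.setoid (rot * inv)))
    = Nat.card (Quotient (Equiv.Perm.SameCycle.setoid inv)) + 2

namespace RootedMap

/-- `M.face d` is the oriented edge that follows `d` on the contour of the face on the left
of `d`: reverse `d`, then turn clockwise around its end point. -/
def face (M : RootedMap) : Equiv.Perm M.Dart := M.rot * M.inv

noncomputable def numEdges (M : RootedMap) : ℕ :=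
  Nat.card (Quotient (Equiv.Perm.SameCycle.setoid M.inv))

noncomputable def numFaces (M : RootedMap) : ℕ :=
  Nat.card (Quotient (Equiv.Perm.SameCycle.setoid M.face))

/-- Two oriented edges start at the same vertex. -/
def SameVertex (M : RootedMap) (d d' : M.Dart) : Prop := M.rot.SameCycle d d'

/-- A planted plane tree is a map with a single face. -/
def IsTree (M : RootedMap) : Prop := M.numFaces = 1

/-- The oriented edges of the boundary: those whose left face is the root face,
which is the external face. -/
def boundary (M : RootedMap) : Set M.Dart := {d | M.face.SameCycle M.root d}

/-- `M` is a map with a simple boundary of length `n` and with `f` internal faces: the contour of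
the external face consists of `n` oriented edges, and it visits no vertex twice. -/
structure IsSimpleBoundary (M : RootedMap) (f n : ℕ) : Prop where
  numFaces_eq : M.numFaces = f + 1
  ncard_boundary : M.boundary.ncard = n
  simple : ∀ d ∈ M.boundary, ∀ d' ∈ M.boundary, M.SameVertex d d' → d = d'

/-- `ι` presents `T` (regardless of its root) as a submap of `M`, that is, as what remains of `M`
when edges and vertices are suppressed: the cyclic order around each vertex of `T` is the cyclic
order of `M`, in which the suppressed edges are skipped. -/
structure IsSubmap (T M : RootedMap) (ι : T.Dart → M.Dart) : Prop where
  injective : Function.Injective ι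
  map_inv : ∀ d, ι (T.inv d) = M.inv (ι d)
  map_rot : ∀ d, ∃ k : ℕ, 1 ≤ k ∧ (M.rot ^ k) (ι d) = ι (T.rot d) ∧
    ∀ j : ℕ, 1 ≤ j → j < k → (M.rot ^ j) (ι d) ∉ Set.range ι

/-- The set `S` of oriented edges is an (unrooted) tree with `m` edges that is a submap of `M`,
and the only vertex which it shares with the boundary of `M` is the root vertex of `M`. -/
structure IsRootedSubtree (M : RootedMap) (S : Set M.Dart) (m : ℕ) : Prop where
  tree : ∃ (T : RootedMap) (ι : T.Dart → M.Dart),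
    T.IsTree ∧ T.numEdges = m ∧ IsSubmap T M ι ∧ Set.range ι = S
  contains_root : ∃ d ∈ S, M.SameVertex d M.root
  only_root : ∀ d ∈ S, ∀ b ∈ M.boundary, M.SameVertex d b → M.SameVertex d M.root

/-- An isomorphism of rooted maps (an orientation preserving homeomorphism of the sphere that
respects the roots). -/
structure Iso (M N : RootedMap) where
  toEquiv : M.Dart ≃ N.Dart
  map_rot : ∀ d, toEquiv (M.rot d) = N.rot (toEquiv d)
  map_inv : ∀ d, toEquiv (M.inv d) = N.inv (toEquiv d)
  map_root : toEquiv M.root = N.root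

def Iso.refl (M : RootedMap) : Iso M M := ⟨Equiv.refl _, fun _ => rfl, fun _ => rfl, rfl⟩

def Iso.symm {M N : RootedMap} (e : Iso M N) : Iso N M where
  toEquiv := e.toEquiv.symm
  map_rot d := by rw [Equiv.symm_apply_eq, e.map_rot, Equiv.apply_symm_apply]
  map_inv d := by rw [Equiv.symm_apply_eq, e.map_inv, Equiv.apply_symm_apply]
  map_root := by rw [Equiv.symm_apply_eq, e.map_root]

def Iso.trans {M N P : RootedMap} (e : Iso M N) (e' : Iso N P) : Iso M P where
  toEquiv := e.toEquiv.trans e'.toEquiv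
  map_rot d := by simp [e.map_rot, e'.map_rot]
  map_inv d := by simp [e.map_inv, e'.map_inv]
  map_root := by simp [e.map_root, e'.map_root]

/-- Maps are considered up to isomorphism. -/
instance setoid : Setoid RootedMap where
  r M N := Nonempty (Iso M N)
  iseqv :=
    { refl := fun M => ⟨Iso.refl M⟩
      symm := fun ⟨e⟩ => ⟨e.symm⟩
      trans := fun ⟨e⟩ ⟨e'⟩ => ⟨e.trans e'⟩ }

end RootedMap

/-- Planted plane trees with `m` edges, as concrete maps. -/
def PlaneTreeRep (m : ℕ) : Type 1 := {T : RootedMap // T.IsTree ∧ T.numEdges = m}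

/-- Maps with a simple boundary of length `n` and `f` internal faces, as concrete maps. -/
def SimpleBoundaryMapRep (f n : ℕ) : Type 1 := {M : RootedMap // M.IsSimpleBoundary f n}

/-- Tree-decorated maps with a simple boundary of length `n`, with `f` internal faces and a
decorating tree with `m` edges, as concrete maps with a set of oriented edges. -/
structure DecoratedMapRep (f n m : ℕ) where
  map : RootedMap
  tree : Set map.Dart
  isSimpleBoundary : map.IsSimpleBoundary f n
  isRootedSubtree : map.IsRootedSubtree tree m

instance PlaneTreeRep.setoid (m : ℕ) : Setoid (PlaneTreeRep m) :=
  RootedMap.setoid.comap Subtype.val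

instance SimpleBoundaryMapRep.setoid (f n : ℕ) : Setoid (SimpleBoundaryMapRep f n) :=
  RootedMap.setoid.comap Subtype.val

/-- Decorated maps are considered up to the isomorphisms of maps that match the trees. -/
instance DecoratedMapRep.setoid (f n m : ℕ) : Setoid (DecoratedMapRep f n m) where
  r X Y := ∃ e : RootedMap.Iso X.map Y.map, ∀ d, e.toEquiv d ∈ Y.tree ↔ d ∈ X.tree
  iseqv :=
    { refl := fun X => ⟨RootedMap.Iso.refl X.map, fun _ => Iff.rfl⟩
      symm := fun {X Y} ⟨e, he⟩ => ⟨e.symm, fun d => by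
        have h := he (e.toEquiv.symm d)
        rw [Equiv.apply_symm_apply] at h
        exact h.symm⟩
      trans := fun ⟨e, he⟩ ⟨e', he'⟩ =>
        ⟨e.trans e', fun d => (he' (e.toEquiv d)).trans (he d)⟩ }

/-- The set of planted plane trees with `m` edges. -/
def PlaneTree (m : ℕ) : Type 1 := Quotient (PlaneTreeRep.setoid m)

/-- The set of maps with a simple boundary of length `n` and `f` internal faces. -/
def SimpleBoundaryMap (f n : ℕ) : Type 1 := Quotient (SimpleBoundaryMapRep.setoid f n)

/-- The set of tree-decorated maps with a simple boundary of length `n`, with `f` internal faces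
and a tree with `m` edges. -/
def DecoratedMap (f n m : ℕ) : Type 1 := Quotient (DecoratedMapRep.setoid f n m)

/-- `M`, decorated by the set `S` of oriented edges, is obtained from the map `B` with a simple
boundary of length `n + 2 * m` by gluing the plane tree `T` with `m` edges to the boundary.
Write `b 0 = B.root, b 1, …` for the contour of the external face of `B`, and
`t 0 = T.root, t 1, …` for the contour of `T`. Starting from the root vertex and walking along
the boundary of `B` with the interior of `B` on the left, one reads the oriented edges
`B.inv (b (n + 2 * m - 1)), B.inv (b (n + 2 * m - 2)), …`; the first `2 * m` of them become
the contour of `T`, and `π` is the resulting identification of oriented edges. -/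
structure RootedMap.GluingMap (n m : ℕ) (T B M : RootedMap) (S : Set M.Dart)
    (π : B.Dart → M.Dart) (τ : T.Dart → M.Dart) : Prop where
  surjective : Function.Surjective π
  map_inv : ∀ d, π (B.inv d) = M.inv (π d)
  map_root : π B.root = M.root
  /-- the internal faces are kept -/
  map_face : ∀ d, d ∉ B.boundary → π (B.face d) = M.face (π d)
  /-- the part of the boundary that is not glued keeps its order -/
  map_boundary : ∀ i : ℕ, i + 1 < n →
    π ((B.face ^ (i + 1)) B.root) = M.face (π ((B.face ^ i) B.root))
  /-- `T` becomes the submap `S` -/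
  isSubmap : RootedMap.IsSubmap T M τ
  range_eq : Set.range τ = S
  /-- the glued part of the boundary follows the contour of `T` -/
  map_contour : ∀ i : ℕ, i < 2 * m →
    π (B.inv ((B.face ^ (n + 2 * m - 1 - i)) B.root)) = τ ((T.face ^ i) T.root)
  /-- nothing else is identified: distinct oriented edges have the same image only if both of
  them belong to glued boundary edges -/
  glued : ∀ d d', π d = π d' → d ≠ d' → ∃ i k : ℕ, i < 2 * m ∧ k < 2 * m ∧
    (T.face ^ k) T.root = T.inv ((T.face ^ i) T.root) ∧
    ((d = B.inv ((B.face ^ (n + 2 * m - 1 - i)) B.root) ∧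
        d' = (B.face ^ (n + 2 * m - 1 - k)) B.root) ∨
      (d' = B.inv ((B.face ^ (n + 2 * m - 1 - i)) B.root) ∧
        d = (B.face ^ (n + 2 * m - 1 - k)) B.root))

/-- The decorated map `X` is the result of gluing the plane tree `T` to the map `B`. -/
def IsGluing {f n m : ℕ} (T : PlaneTreeRep m) (B : SimpleBoundaryMapRep f (n + 2 * m))
    (X : DecoratedMapRep f n m) : Prop :=
  ∃ (π : B.1.Dart → X.map.Dart) (τ : T.1.Dart → X.map.Dart),
    RootedMap.GluingMap n m T.1 B.1 X.map X.tree π τ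

/-! Gluing is undone by cutting along the tree, and one relation, `CutData`, describes both. The
oriented edges of `B` are those of `M` (through `ι`) and one new boundary edge `β t` for each
oriented edge `t` of `T`. The contours of `B` are those of `M`, with the reversed contour of `T`
spliced in just before the root. The edge `γ t` of the tree is opposite to `γ (T.inv t)` in `M`,
while `ι (γ t)` is opposite to `β t` in `B`. So, for a tree with `m` edges, `B` has as many faces as
`M` and `m` more edges.

The vertices carry the difficulty. The tree has `2 * m` corners, and the external face splits the
root corner in two. In `B`, the rotation closes each of these `2 * m + 1` corners on itself. Hence
the corners are arranged in `M` as they are in the plane tree `T` if and only if each of them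
becomes a vertex of its own in `B` (`CutData.firstReturn_iff`). When gluing, the simple boundary of
`B` gives the second property (`firstReturn_of_simple`), and `T` becomes a submap. When cutting, the
submap gives the first one (`firstReturn_corner`), and `B` gets a simple boundary (`simple_cut`).
Counting vertices then transfers Euler's relation both ways (`planar_iff`).

Existence comes from `exists_glued` and `exists_cut`, uniqueness from `glued_unique` and
`cut_unique`. The root of the tree is not part of the decoration, but it is forced: it is the first
edge of the tree met clockwise from the root of `M`, so that `subtree_unique` recovers the planted
tree. Finally, `GluingMap.exists_cutData` and `exists_gluingMap` translate between the gluing of the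
theorem and `CutData`. -/

open Equiv

/-! ### First returns of a permutation to a subset -/

/-- `Hits σ A x y`: `y` is the first element of `A` in the sequence `x, σ x, σ (σ x), …`. -/
inductive Hits {X : Type*} (σ : Perm X) (A : Set X) : X → X → Prop
  | here {x : X} : x ∈ A → Hits σ A x x
  | step {x y : X} : x ∉ A → Hits σ A (σ x) y → Hits σ A x y

namespace Hits

variable {X : Type*} {σ : Perm X} {A A' : Set X} {x y z : X}

theorem mem (h : Hits σ A x y) : y ∈ A := by
  induction h with
  | here h => exact h
  | step _ _ ih => exact ih

theorem exists_pow (h : Hits σ A x y) :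
    ∃ k : ℕ, (σ ^ k) x = y ∧ ∀ j < k, (σ ^ j) x ∉ A := by
  induction h with
  | here h => exact ⟨0, rfl, by simp⟩
  | @step x y hx _ ih =>
    obtain ⟨k, hk, hj⟩ := ih
    refine ⟨k + 1, by rw [pow_succ]; exact hk, fun j hjk => ?_⟩
    cases j with
    | zero => exact hx
    | succ j => rw [pow_succ]; exact hj j (by omega)

theorem of_pow {k : ℕ} (hk : (σ ^ k) x ∈ A) (hj : ∀ j < k, (σ ^ j) x ∉ A) :
    Hits σ A x ((σ ^ k) x) := by
  induction k generalizing x with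
  | zero => exact here hk
  | succ k ih =>
    rw [pow_succ] at hk ⊢
    refine step (hj 0 (by omega)) (ih hk fun j hjk => ?_)
    have := hj (j + 1) (by omega)
    rwa [pow_succ] at this

theorem exists_minimal_pow {k : ℕ} (hk : (σ ^ k) x ∈ A) :
    ∃ k : ℕ, (σ ^ k) x ∈ A ∧ ∀ j < k, (σ ^ j) x ∉ A := by
  classical
  have h : ∃ k : ℕ, (σ ^ k) x ∈ A := ⟨k, hk⟩
  exact ⟨Nat.find h, Nat.find_spec h, fun j hj => Nat.find_min h hj⟩

theorem exists_of_sameCycle [Finite X] (h : σ.SameCycle x y) (hy : y ∈ A) :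
    ∃ z, Hits σ A x z := by
  obtain ⟨k, rfl⟩ := h.exists_nat_pow_eq
  obtain ⟨l, hl, hj⟩ := exists_minimal_pow hy
  exact ⟨_, of_pow hl hj⟩

theorem sameCycle (h : Hits σ A x y) : σ.SameCycle x y := by
  obtain ⟨k, rfl, -⟩ := h.exists_pow
  exact ⟨k, by simp⟩

theorem unique (h : Hits σ A x y) (h' : Hits σ A x z) : y = z := by
  induction h with
  | here h =>
    cases h' with
    | here => rfl
    | step hx => exact absurd h hx
  | step hx _ ih =>
    cases h' with
    | here hx' => exact absurd hx' hx
    | step _ h => exact ih h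

theorem eq_of_mem (h : Hits σ A x y) (hx : x ∈ A) : x = y := (here hx).unique h

theorem trans_subset (hA : A' ⊆ A) (h : Hits σ A x y) (h' : Hits σ A' y z) : Hits σ A' x z := by
  induction h with
  | here => exact h'
  | step hx _ ih => exact step (fun hx' => hx (hA hx')) (ih h')

/-- The first return map is injective. -/
theorem return_injective {a a' : X} (ha : a ∈ A) (ha' : a' ∈ A) (h : Hits σ A (σ a) y)
    (h' : Hits σ A (σ a') y) : a = a' := by
  obtain ⟨k, hk, hj⟩ := h.exists_pow
  obtain ⟨l, hl, hj'⟩ := h'.exists_pow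
  clear h h'
  subst hl
  -- Cancel the shorter power: if the lengths differ, `a` itself lies on the stretch from `σ a'` to
  -- the hit, which avoids `A`.
  have key : ∀ (k l : ℕ) (a a' : X), a ∈ A → (∀ j < l, (σ ^ j) (σ a') ∉ A) → k ≤ l →
      (σ ^ k) (σ a) = (σ ^ l) (σ a') → a = a' := by
    intro k l a a' ha hj' hkl hk
    obtain ⟨d, rfl⟩ := Nat.exists_eq_add_of_le hkl
    rw [pow_add, Perm.mul_apply] at hk
    have h2 := (σ ^ k).injective hk
    cases d with
    | zero => exact σ.injective h2
    | succ d =>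
      rw [pow_succ', Perm.mul_apply] at h2
      have h3 := σ.injective h2
      exact absurd (h3 ▸ ha) (hj' d (by omega))
  rcases le_total k l with hkl | hkl
  · exact key k l a a' ha hj' hkl hk
  · exact (key l k a' a ha' hj hkl hk.symm).symm

/-- Adding one more element `w` to the set `A`. -/
theorem insert_or {w : X} (h : Hits σ A x y) (hw : w ∉ A) :
    (Hits σ (insert w A) x w ∧ Hits σ A (σ w) y) ∨ Hits σ (insert w A) x y := by
  induction h with
  | here h => exact Or.inr (here (Set.mem_insert_of_mem _ h))
  | @step x y hx h ih =>
    by_cases hxw : x = w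
    · subst hxw
      exact Or.inl ⟨here (Set.mem_insert _ _), h⟩
    · have hx' : x ∉ insert w A := by simp [hxw, hx]
      rcases ih with ⟨h1, h2⟩ | h1
      · exact Or.inl ⟨step hx' h1, h2⟩
      · exact Or.inr (step hx' h1)

/-- A first hit is not preceded by the predecessor of the starting point. -/
theorem exists_insert_inv [Finite X] (h : σ.SameCycle x y) (hy : y ∈ A) :
    ∃ z, Hits σ A x z ∧ Hits σ (insert (σ⁻¹ x) A) x z := by
  obtain ⟨k, rfl⟩ := h.exists_nat_pow_eq
  obtain ⟨l, hl, hj⟩ := exists_minimal_pow hy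
  refine ⟨_, of_pow hl hj, of_pow (Set.mem_insert_of_mem _ hl) fun j hjl hmem => ?_⟩
  -- An orbit that meets `σ⁻¹ x` is back at `x` one step later, so the hit would have occurred
  -- before.
  rcases hmem with hmem | hmem
  · have h1 : (σ ^ (j + 1)) x = x := by
      rw [pow_succ', Perm.mul_apply, hmem, ← Perm.mul_apply, mul_inv_cancel, Perm.one_apply]
    obtain ⟨d, rfl⟩ := Nat.exists_eq_add_of_le (Nat.succ_le_of_lt hjl)
    refine hj d (by omega) ?_
    have h2 : j.succ + d = d + (j + 1) := by omega
    rwa [h2, pow_add, Perm.mul_apply, h1] at hl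
  · exact hj j hjl hmem

end Hits

/-- `ρ` is the first return map of `σ` to the image of `ι`. -/
def FirstReturn {X Y : Type*} (σ : Perm X) (ρ : Perm Y) (ι : Y → X) : Prop :=
  ∀ y, Hits σ (Set.range ι) (σ (ι y)) (ι (ρ y))

/-- The right-hand side is the condition `map_rot` of `IsSubmap`: a submap carries the permutation
that the ambient rotation induces on it. -/
theorem firstReturn_iff {X Y : Type*} {σ : Perm X} {ρ : Perm Y} {ι : Y → X} :
    FirstReturn σ ρ ι ↔ ∀ y, ∃ k : ℕ, 1 ≤ k ∧ (σ ^ k) (ι y) = ι (ρ y) ∧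
      ∀ j : ℕ, 1 ≤ j → j < k → (σ ^ j) (ι y) ∉ Set.range ι := by
  refine forall_congr' fun y => ⟨fun h => ?_, ?_⟩
  · obtain ⟨k, hk, hj⟩ := h.exists_pow
    refine ⟨k + 1, by omega, by rw [pow_succ]; exact hk, fun j h1 h2 => ?_⟩
    obtain ⟨i, rfl⟩ := Nat.exists_eq_add_of_le' h1
    rw [pow_succ]
    exact hj i (by omega)
  · rintro ⟨k, h1, hk, hj⟩
    obtain ⟨i, rfl⟩ := Nat.exists_eq_add_of_le' h1
    rw [pow_succ, Perm.mul_apply] at hk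
    rw [← hk]
    refine Hits.of_pow (by rw [hk]; exact ⟨_, rfl⟩) fun j hji => ?_
    have := hj (j + 1) (by omega) (by omega)
    rwa [pow_succ] at this

namespace FirstReturn

variable {X Y Z : Type*} {σ : Perm X} {ρ : Perm Y} {κ : Perm Z} {ι : Y → X} {j : Z → Y}

/-- Each step of `ρ` is a stretch of a `σ`-orbit that avoids the image of `ι` before its end, and
such stretches can be concatenated. -/
theorem comp (h : FirstReturn σ ρ ι) (hι : Function.Injective ι) (h' : FirstReturn ρ κ j) :
    FirstReturn σ κ (ι ∘ j) := by
  have key : ∀ a b, Hits ρ (Set.range j) a b →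
      Hits σ (Set.range (ι ∘ j)) (ι a) (ι b) := by
    intro a b hab
    induction hab with
    | here h => obtain ⟨c, rfl⟩ := h; exact Hits.here ⟨c, rfl⟩
    | @step a b ha _ ih =>
      refine Hits.step ?_ ((h a).trans_subset ?_ ih)
      · rintro ⟨c, hc⟩
        exact ha ⟨c, hι hc⟩
      · rintro _ ⟨c, rfl⟩
        exact ⟨_, rfl⟩
  intro z
  refine (h (j z)).trans_subset ?_ (key _ _ (h' z))
  rintro _ ⟨c, rfl⟩
  exact ⟨_, rfl⟩

/-- Along the `σ`-orbit of `ι y`, the next element of the image changes only when the orbit passes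
through the image, and then by one step of `ρ`. -/
theorem sameCycle_of_sameCycle [Finite X] (h : FirstReturn σ ρ ι) (hι : Function.Injective ι)
    {y y' : Y} (hs : σ.SameCycle (ι y) (ι y')) : ρ.SameCycle y y' := by
  obtain ⟨k, hk⟩ := hs.exists_nat_pow_eq
  have key : ∀ k : ℕ, ∃ a, Hits σ (Set.range ι) ((σ ^ k) (ι y)) (ι a) ∧ ρ.SameCycle y a := by
    intro k
    induction k with
    | zero => exact ⟨y, Hits.here ⟨y, rfl⟩, Perm.SameCycle.refl _ _⟩
    | succ k ih =>
      obtain ⟨a, ha, hya⟩ := ih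
      rw [pow_succ', Perm.mul_apply]
      generalize (σ ^ k) (ι y) = x at ha
      cases ha with
      | here => exact ⟨ρ a, h a, hya.trans ⟨1, by simp⟩⟩
      | step _ ha => exact ⟨a, ha, hya⟩
  obtain ⟨a, ha, hya⟩ := key k
  rw [hk] at ha
  rwa [hι (ha.eq_of_mem ⟨y', rfl⟩)]

theorem sameCycle_apply (h : FirstReturn σ ρ ι) (y : Y) : σ.SameCycle (ι y) (ι (ρ y)) :=
  Perm.SameCycle.trans ⟨1, by simp⟩ (h y).sameCycle

theorem sameCycle_map [Finite Y] (h : FirstReturn σ ρ ι) {y y' : Y} (hs : ρ.SameCycle y y') :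
    σ.SameCycle (ι y) (ι y') := by
  obtain ⟨k, rfl⟩ := hs.exists_nat_pow_eq
  induction k with
  | zero => exact Perm.SameCycle.refl _ _
  | succ k ih =>
    rw [pow_succ', Perm.mul_apply]
    exact (ih ⟨k, by simp⟩).trans (h.sameCycle_apply _)

theorem sameCycle_iff [Finite X] [Finite Y] (h : FirstReturn σ ρ ι) (hι : Function.Injective ι)
    {y y' : Y} : σ.SameCycle (ι y) (ι y') ↔ ρ.SameCycle y y' :=
  ⟨h.sameCycle_of_sameCycle hι, h.sameCycle_map⟩

theorem exists_perm [Finite X] (σ : Perm X) (hι : Function.Injective ι) :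
    ∃ ρ : Perm Y, FirstReturn σ ρ ι := by
  have hex : ∀ y, ∃ y', Hits σ (Set.range ι) (σ (ι y)) (ι y') := by
    intro y
    obtain ⟨z, hz⟩ := Hits.exists_of_sameCycle (σ := σ) (A := Set.range ι) (x := σ (ι y))
      (y := ι y) ⟨-1, by simp⟩ ⟨y, rfl⟩
    obtain ⟨y', rfl⟩ := hz.mem
    exact ⟨y', hz⟩
  choose f hf using hex
  have hinj : Function.Injective f := by
    intro y y' hyy
    refine hι (Hits.return_injective (A := Set.range ι) ⟨y, rfl⟩ ⟨y', rfl⟩ (hf y) ?_)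
    rw [hyy]
    exact hf y'
  have := Finite.of_injective ι hι
  exact ⟨Equiv.ofBijective f (Finite.injective_iff_bijective.mp hinj), hf⟩

end FirstReturn

/-! ### Counting cycles -/

/-- The number of cycles of a permutation, fixed points included. -/
noncomputable def numCycles {X : Type*} (σ : Perm X) : ℕ :=
  Nat.card (Quotient (Perm.SameCycle.setoid σ))

/-- The cycles of `σ` that do not meet `A`. -/
def cyclesOff {X : Type*} (σ : Perm X) (A : Set X) : Set (Quotient (Perm.SameCycle.setoid σ)) :=
  {q | ∀ x ∈ A, q ≠ Quotient.mk _ x}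

theorem mk_mem_cyclesOff {X : Type*} {σ : Perm X} {A : Set X} {x : X} :
    (Quotient.mk (Perm.SameCycle.setoid σ) x) ∈ cyclesOff σ A ↔ ∀ a ∈ A, ¬ σ.SameCycle x a :=
  forall₂_congr fun _ _ => not_congr Quotient.eq

/-- The cycles of `ρ` correspond to the cycles of `σ` that meet the image of `ι`. -/
theorem FirstReturn.numCycles_eq {X Y : Type*} [Finite X] {σ : Perm X} {ρ : Perm Y} {ι : Y → X}
    (h : FirstReturn σ ρ ι) (hι : Function.Injective ι) :
    numCycles σ = numCycles ρ + (cyclesOff σ (Set.range ι)).ncard := by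
  have := Finite.of_injective ι hι
  let g : Quotient (Perm.SameCycle.setoid ρ) → Quotient (Perm.SameCycle.setoid σ) :=
    Quotient.map ι fun _ _ hs => h.sameCycle_map hs
  have hg : Function.Injective g := by
    rintro ⟨a⟩ ⟨b⟩ hab
    exact Quotient.sound (h.sameCycle_of_sameCycle hι (Quotient.exact hab))
  have hr : cyclesOff σ (Set.range ι) = (Set.range g)ᶜ := by
    ext q
    constructor
    · rintro hq ⟨⟨y⟩, rfl⟩
      exact hq _ ⟨y, rfl⟩ rfl
    · rintro hq _ ⟨y, rfl⟩ rfl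
      exact hq ⟨Quotient.mk _ y, rfl⟩
  rw [hr, numCycles, numCycles, ← Set.ncard_add_ncard_compl (Set.range g),
    ← Nat.card_range_of_injective hg, Nat.card_coe_set_eq]

theorem FirstReturn.numCycles_eq_of_meets {X Y : Type*} [Finite X] {σ : Perm X} {ρ : Perm Y}
    {ι : Y → X} (h : FirstReturn σ ρ ι) (hι : Function.Injective ι)
    (hm : ∀ x, ∃ y, σ.SameCycle x (ι y)) : numCycles σ = numCycles ρ := by
  have he : cyclesOff σ (Set.range ι) = ∅ := by
    refine Set.eq_empty_of_forall_notMem fun q hq => ?_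
    obtain ⟨x, rfl⟩ := Quotient.mk_surjective q
    obtain ⟨y, hy⟩ := hm x
    exact hq _ ⟨y, rfl⟩ (Quotient.sound hy)
  rw [h.numCycles_eq hι, he, Set.ncard_empty, add_zero]

theorem numCycles_one {X : Type*} : numCycles (1 : Perm X) = Nat.card X := by
  refine (Nat.card_congr (Equiv.ofBijective (Quotient.mk (Perm.SameCycle.setoid (1 : Perm X)))
    ⟨fun a b hab => ?_, Quotient.mk_surjective⟩)).symm
  obtain ⟨k, hk⟩ := Quotient.exact hab
  simpa using hk

section Agree

variable {X Y : Type*} {σ : Perm X} {σ' : Perm Y} {ι : X → Y} {A : Set X}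

theorem pow_map_of_agree (hσ : ∀ x ∉ A, σ' (ι x) = ι (σ x)) {x : X}
    (hx : ∀ a ∈ A, ¬ σ.SameCycle x a) (k : ℕ) : (σ' ^ k) (ι x) = ι ((σ ^ k) x) := by
  induction k with
  | zero => rfl
  | succ k ih =>
    rw [pow_succ', pow_succ', Perm.mul_apply, Perm.mul_apply, ih, hσ]
    exact fun hA => hx _ hA ⟨k, by simp⟩

theorem not_sameCycle_of_agree [Finite Y] (hσ : ∀ x ∉ A, σ' (ι x) = ι (σ x))
    (hι : Function.Injective ι) {x : X} (hx : ∀ a ∈ A, ¬ σ.SameCycle x a) :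
    ∀ a ∈ A, ¬ σ'.SameCycle (ι x) (ι a) := by
  intro a ha hs
  obtain ⟨k, hk⟩ := hs.exists_nat_pow_eq
  rw [pow_map_of_agree hσ hx] at hk
  exact hx a ha ⟨k, by simpa using hι hk⟩

theorem sameCycle_map_iff_of_agree [Finite X] [Finite Y] (hσ : ∀ x ∉ A, σ' (ι x) = ι (σ x))
    (hι : Function.Injective ι) {x x' : X} (hx : ∀ a ∈ A, ¬ σ.SameCycle x a) :
    σ'.SameCycle (ι x) (ι x') ↔ σ.SameCycle x x' := by
  constructor
  · intro hs
    obtain ⟨k, hk⟩ := hs.exists_nat_pow_eq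
    rw [pow_map_of_agree hσ hx] at hk
    exact ⟨k, by simpa using hι hk⟩
  · intro hs
    obtain ⟨k, rfl⟩ := hs.exists_nat_pow_eq
    rw [← pow_map_of_agree hσ hx]
    exact ⟨k, by simp⟩

/-- Two permutations which agree off `A` have as many cycles off `A`. -/
theorem ncard_cyclesOff_eq [Finite X] [Finite Y] (hι : Function.Injective ι)
    (hσ : ∀ x ∉ A, σ' (ι x) = ι (σ x)) (hm : ∀ y, ∃ x, σ'.SameCycle y (ι x)) :
    (cyclesOff σ A).ncard = (cyclesOff σ' (ι '' A)).ncard := by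
  let f : Quotient (Perm.SameCycle.setoid σ) → Quotient (Perm.SameCycle.setoid σ') :=
    fun q => Quotient.mk _ (ι q.out)
  have hout : ∀ q ∈ cyclesOff σ A, ∀ a ∈ A, ¬ σ.SameCycle q.out a := by
    intro q hq
    rw [← mk_mem_cyclesOff, Quotient.out_eq]
    exact hq
  have hinj : Set.InjOn f (cyclesOff σ A) := by
    intro q hq q' hq' hqq
    rw [← Quotient.out_eq q, ← Quotient.out_eq q']
    exact Quotient.sound
      ((sameCycle_map_iff_of_agree hσ hι (hout q hq)).1 (Quotient.exact hqq))
  rw [← hinj.ncard_image]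
  congr 1
  ext r
  constructor
  · rintro ⟨q, hq, rfl⟩ _ ⟨a, ha, rfl⟩ he
    exact not_sameCycle_of_agree hσ hι (hout q hq) a ha (Quotient.exact he)
  · obtain ⟨y, rfl⟩ := Quotient.mk_surjective r
    intro hr
    obtain ⟨x, hx⟩ := hm y
    -- The walk of `σ` from `x` to its first element of `A` stays off `A` until then, so `σ'` copies
    -- it and would reach `ι '' A`.
    have hx' : ∀ a ∈ A, ¬ σ.SameCycle x a := by
      intro a ha hs
      obtain ⟨z, hz⟩ := Hits.exists_of_sameCycle hs ha
      have key : σ'.SameCycle (ι x) (ι z) := by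
        clear hx hs
        induction hz with
        | here => exact Perm.SameCycle.refl _ _
        | step hA _ ih =>
          rw [← hσ _ hA] at ih
          exact Perm.SameCycle.trans ⟨1, by simp⟩ ih
      exact hr _ ⟨z, hz.mem, rfl⟩ (Quotient.sound (hx.trans key))
    refine ⟨_, mk_mem_cyclesOff.2 hx', Quotient.sound (Perm.SameCycle.symm (hx.trans ?_))⟩
    exact (sameCycle_map_iff_of_agree hσ hι hx').2
      (Quotient.mk_out (s := Perm.SameCycle.setoid σ) x).symm

end Agree

/-- Every cycle is a pair: a cycle and a Boolean, choosing between its representative and the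
partner, name each element exactly once. -/
theorem two_mul_numCycles {X : Type*} [Finite X] {α : Perm X} (h1 : ∀ d, α (α d) = d)
    (h2 : ∀ d, α d ≠ d) : 2 * numCycles α = Nat.card X := by
  have hs : ∀ a b, α.SameCycle a b ↔ b = a ∨ b = α a := by
    intro a b
    constructor
    · intro h
      obtain ⟨k, rfl⟩ := h.exists_nat_pow_eq
      induction k with
      | zero => exact Or.inl rfl
      | succ k ih =>
        rw [pow_succ', Perm.mul_apply]
        rcases ih ⟨k, by simp⟩ with h | h
        · exact Or.inr (by rw [h])
        · exact Or.inl (by rw [h, h1])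
    · rintro (rfl | rfl)
      · exact Perm.SameCycle.refl _ _
      · exact ⟨1, by simp⟩
  let q : X → Quotient (Perm.SameCycle.setoid α) := Quotient.mk _
  have hq : ∀ a b, q a = q b ↔ b = a ∨ b = α a := fun a b => Quotient.eq.trans (hs a b)
  let e : Quotient (Perm.SameCycle.setoid α) × Bool → X :=
    fun p => if p.2 then p.1.out else α p.1.out
  have hqe : ∀ p, q (e p) = p.1 := by
    rintro ⟨p, b⟩
    have h0 : q p.out = p := Quotient.out_eq p
    cases b
    · have : q (α p.out) = q p.out := ((hq _ _).2 (Or.inr rfl)).symm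
      exact this.trans h0
    · exact h0
  have he : Function.Bijective e := by
    constructor
    · rintro ⟨p, b⟩ ⟨p', b'⟩ hpp
      have h3 : p = p' := (hqe (p, b)).symm.trans ((congrArg q hpp).trans (hqe (p', b')))
      subst h3
      cases b <;> cases b'
      · rfl
      · exact absurd hpp (h2 _)
      · exact absurd hpp.symm (h2 _)
      · rfl
    · intro x
      have h3 : q (q x).out = q x := Quotient.out_eq (q x)
      rcases (hq _ _).1 h3 with h | h
      · exact ⟨(q x, true), h.symm⟩
      · exact ⟨(q x, false), h.symm⟩
  rw [← Nat.card_congr (Equiv.ofBijective e he), Nat.card_prod, numCycles]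
  simp [mul_comm]

/-! ### Rotation systems and the corners of a tree -/

/-- A rotation system: a rooted map that is not required to be connected or planar. -/
structure RotSys where
  Dart : Type
  finite_dart : Finite Dart
  rot : Perm Dart
  inv : Perm Dart
  inv_inv : ∀ d, inv (inv d) = d
  inv_ne : ∀ d, inv d ≠ d
  root : Dart

instance (M : RotSys) : Finite M.Dart := M.finite_dart

instance (M : RootedMap) : Finite M.Dart := M.finite_dart

/-- The rotation system of a rooted map. -/
abbrev RootedMap.toRotSys (M : RootedMap) : RotSys :=
  ⟨M.Dart, M.finite_dart, M.rot, M.inv, M.inv_inv, M.inv_ne, M.root⟩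

namespace RotSys

/-- The contours of the faces. -/
def face (M : RotSys) : Perm M.Dart := M.rot * M.inv

theorem face_apply (M : RotSys) (d : M.Dart) : M.face d = M.rot (M.inv d) := rfl

theorem face_inv (M : RotSys) (d : M.Dart) : M.face (M.inv d) = M.rot d := by
  rw [face_apply, M.inv_inv]

/-- The oriented edges of the contour of the root face. -/
def boundary (M : RotSys) : Set M.Dart := {d | M.face.SameCycle M.root d}

theorem root_mem_boundary (M : RotSys) : M.root ∈ M.boundary := Perm.SameCycle.refl _ _

theorem face_mem_boundary (M : RotSys) {d : M.Dart} (hd : d ∈ M.boundary) :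
    M.face d ∈ M.boundary := Perm.SameCycle.trans hd ⟨1, by simp⟩

theorem mem_boundary_of_face (M : RotSys) {d : M.Dart} (hd : M.face d ∈ M.boundary) :
    d ∈ M.boundary := Perm.SameCycle.trans hd ⟨-1, by simp⟩

/-- The rotation around the corners of a planted plane tree, of which the root corner has been
split into two corners: `some t` is the corner just before the oriented edge `t` in clockwise
order, except for the first part `none` of the root corner. -/
noncomputable def cornerPerm (T : RotSys) : Perm (Option T.Dart) := by
  classical exact swap none (some T.root) * optionCongr T.rot

theorem cornerPerm_none (T : RotSys) : T.cornerPerm none = some T.root := by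
  simp [cornerPerm]

theorem cornerPerm_some_of_eq (T : RotSys) {t : T.Dart} (h : T.rot t = T.root) :
    T.cornerPerm (some t) = none := by
  simp [cornerPerm, h]

theorem cornerPerm_some_of_ne (T : RotSys) {t : T.Dart} (h : T.rot t ≠ T.root) :
    T.cornerPerm (some t) = some (T.rot t) := by
  classical
  simp only [cornerPerm, Perm.mul_apply, optionCongr_apply, Option.map_some]
  exact swap_apply_of_ne_of_ne (by simp) (by simpa using h)

theorem firstReturn_cornerPerm (T : RotSys) : FirstReturn T.cornerPerm T.rot some := by
  intro t
  by_cases h : T.rot t = T.root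
  · rw [T.cornerPerm_some_of_eq h]
    refine Hits.step (by simp) ?_
    rw [T.cornerPerm_none, h]
    exact Hits.here ⟨_, rfl⟩
  · rw [T.cornerPerm_some_of_ne h]
    exact Hits.here ⟨_, rfl⟩

theorem numCycles_cornerPerm (T : RotSys) : numCycles T.cornerPerm = numCycles T.rot := by
  refine T.firstReturn_cornerPerm.numCycles_eq_of_meets (Option.some_injective _) fun o => ?_
  cases o with
  | none => exact ⟨T.root, 1, by simp [cornerPerm_none]⟩
  | some t => exact ⟨t, Perm.SameCycle.refl _ _⟩

/-- The oriented edges of `M` that come last in the corners of the tree `γ`. -/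
def corner {Z : Type} (M : RotSys) (γ : Z → M.Dart) : Option Z → M.Dart
  | none => M.rot⁻¹ M.root
  | some t => γ t

theorem range_corner {Z : Type} (M : RotSys) (γ : Z → M.Dart) :
    Set.range (M.corner γ) = insert (M.rot⁻¹ M.root) (Set.range γ) := by
  ext x
  constructor
  · rintro ⟨_ | t, rfl⟩
    · exact Or.inl rfl
    · exact Or.inr ⟨t, rfl⟩
  · rintro (rfl | ⟨t, rfl⟩)
    · exact ⟨none, rfl⟩
    · exact ⟨some t, rfl⟩

theorem rot_corner_none {Z : Type} (M : RotSys) (γ : Z → M.Dart) :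
    M.rot (M.corner γ none) = M.root := by
  simp [corner]

end RotSys

/-! ### Comparing a map with the map cut along a tree -/

/-- If the contour of the external face of `B` ends with the reversed contour of `T`, then the
root follows this part of the contour. -/
theorem hits_root_of_contour {T B : RotSys} {β : T.Dart → B.Dart} {A : Set B.Dart}
    (hT : ∀ t, T.face.SameCycle T.root t) (hβA : ∀ t, β t ∉ A) (hA : B.root ∈ A)
    (hβr : B.face (β T.root) = B.root)
    (hβ : ∀ t, T.face t ≠ T.root → B.face (β (T.face t)) = β t) (t : T.Dart) :
    Hits B.face A (β t) B.root := by
  have h0 : Hits B.face A (β T.root) B.root := by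
    refine Hits.step (hβA _) ?_
    rw [hβr]
    exact Hits.here hA
  obtain ⟨k, rfl⟩ := (hT t).exists_nat_pow_eq
  clear hT
  induction k with
  | zero => exact h0
  | succ k ih =>
    rw [pow_succ', Perm.mul_apply]
    by_cases hr : T.face ((T.face ^ k) T.root) = T.root
    · rwa [hr]
    · refine Hits.step (hβA _) ?_
      rwa [hβ _ hr]

/-- `B` is obtained from `M` by cutting along the tree `γ`, a copy of `T`: `ι` identifies the
oriented edges of `M` with those of `B` that are not on the new part of the boundary, and
`β t` is the oriented edge of the new part of the boundary that is opposite to `γ t`. -/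
structure CutData (T B M : RotSys) (ι : M.Dart → B.Dart) (β : T.Dart → B.Dart)
    (γ : T.Dart → M.Dart) : Prop where
  ι_injective : Function.Injective ι
  β_injective : Function.Injective β
  ι_ne_β : ∀ x t, ι x ≠ β t
  cover : ∀ y, (∃ x, ι x = y) ∨ ∃ t, β t = y
  map_root : ι M.root = B.root
  face_ι : ∀ x, M.face x ≠ M.root → B.face (ι x) = ι (M.face x)
  face_last : ∀ x, M.face x = M.root → B.face (ι x) = β (T.face⁻¹ T.root)
  face_β_root : B.face (β T.root) = B.root
  face_β : ∀ t, T.face t ≠ T.root → B.face (β (T.face t)) = β t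
  inv_β : ∀ t, B.inv (β t) = ι (γ t)
  inv_ι : ∀ x, x ∉ Set.range γ → B.inv (ι x) = ι (M.inv x)
  map_inv : ∀ t, γ (T.inv t) = M.inv (γ t)

namespace CutData

variable {T B M : RotSys} {ι : M.Dart → B.Dart} {β : T.Dart → B.Dart} {γ : T.Dart → M.Dart}

theorem inv_ι_γ (h : CutData T B M ι β γ) (t : T.Dart) : B.inv (ι (γ t)) = β t := by
  rw [← h.inv_β, B.inv_inv]

theorem γ_injective (h : CutData T B M ι β γ) : Function.Injective γ := by
  intro t t' htt
  apply h.β_injective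
  rw [← h.inv_ι_γ, ← h.inv_ι_γ, htt]

theorem corner_none_notMem (h : CutData T B M ι β γ) (hγ : ∀ t, M.face (γ t) ≠ M.root) :
    M.rot⁻¹ M.root ∉ Set.range γ := by
  rintro ⟨t, ht⟩
  refine hγ (T.inv t) ?_
  rw [h.map_inv, M.face_inv, ht]
  simp

theorem corner_injective (h : CutData T B M ι β γ) (hγ : ∀ t, M.face (γ t) ≠ M.root) :
    Function.Injective (M.corner γ) := by
  rintro (_ | t) (_ | t') htt
  · rfl
  · exact absurd ⟨t', htt.symm⟩ (h.corner_none_notMem hγ)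
  · exact absurd ⟨t, htt⟩ (h.corner_none_notMem hγ)
  · exact congrArg some (h.γ_injective htt)

/-- The rotation is the contour permutation after the reversal. Cutting alters the reversal only on
`γ`, and the contours inherited from `M` only before `M.root`: these are the two kinds of corners.
-/
theorem rot_ι (h : CutData T B M ι β γ) {x : M.Dart} (hx : x ∉ Set.range (M.corner γ)) :
    B.rot (ι x) = ι (M.rot x) := by
  rw [M.range_corner, Set.mem_insert_iff, not_or] at hx
  rw [← B.face_inv, h.inv_ι x hx.2, h.face_ι, M.face_inv]
  rw [M.face_inv]
  rintro hr
  exact hx.1 (by rw [← hr]; simp)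

theorem rot_ι_γ_root (h : CutData T B M ι β γ) : B.rot (ι (γ T.root)) = ι M.root := by
  rw [← B.face_inv, h.inv_ι_γ, h.face_β_root, h.map_root]

/-- Together with `rot_β`: in `B` a single new edge separates the last edge of the corner
`T.cornerPerm (some s)` from the edge that follows `γ s` in `M`. -/
theorem rot_ι_corner (h : CutData T B M ι β γ) (hγ : ∀ t, M.face (γ t) ≠ M.root) (s : T.Dart) :
    B.rot (ι (M.corner γ (T.cornerPerm (some s)))) = β (T.inv s) := by
  by_cases hs : T.rot s = T.root
  · rw [T.cornerPerm_some_of_eq hs, ← B.face_inv]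
    change B.face (B.inv (ι (M.rot⁻¹ M.root))) = _
    rw [h.inv_ι _ (h.corner_none_notMem hγ), h.face_last _ (by rw [M.face_inv]; simp)]
    rw [← hs, ← T.face_inv]
    simp
  · rw [T.cornerPerm_some_of_ne hs, ← B.face_inv]
    change B.face (B.inv (ι (γ (T.rot s)))) = _
    rw [h.inv_ι_γ, ← T.face_inv, h.face_β]
    rwa [T.face_inv]

theorem rot_β (h : CutData T B M ι β γ) (hγ : ∀ t, M.face (γ t) ≠ M.root) (s : T.Dart) :
    B.rot (β (T.inv s)) = ι (M.rot (γ s)) := by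
  rw [← B.face_inv, h.inv_β, h.face_ι _ (hγ _), h.map_inv, M.face_inv]

theorem hits_map (h : CutData T B M ι β γ) {x y : M.Dart}
    (hxy : Hits M.rot (Set.range (M.corner γ)) x y) :
    Hits B.rot (Set.range (ι ∘ M.corner γ)) (ι x) (ι y) := by
  induction hxy with
  | here hx => obtain ⟨o, rfl⟩ := hx; exact Hits.here ⟨o, rfl⟩
  | @step x y hx _ ih =>
    refine Hits.step ?_ (by rwa [h.rot_ι hx])
    rintro ⟨o, ho⟩
    exact hx ⟨o, h.ι_injective ho⟩

theorem hits_of_hits_map (h : CutData T B M ι β γ) {x y : M.Dart}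
    (hxy : Hits B.rot (Set.range (ι ∘ M.corner γ)) (ι x) (ι y)) :
    Hits M.rot (Set.range (M.corner γ)) x y := by
  obtain ⟨x', hx'⟩ : ∃ x', x' = ι x := ⟨_, rfl⟩
  obtain ⟨y', hy'⟩ : ∃ y', y' = ι y := ⟨_, rfl⟩
  rw [← hx', ← hy'] at hxy
  induction hxy generalizing x with
  | here hx =>
    obtain rfl := h.ι_injective (hx'.symm.trans hy')
    obtain ⟨o, ho⟩ := hx
    exact Hits.here ⟨o, h.ι_injective (ho.trans hx')⟩
  | step hx _ ih =>
    subst hx'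
    have hx' : x ∉ Set.range (M.corner γ) := by
      rintro ⟨o, rfl⟩
      exact hx ⟨o, rfl⟩
    exact Hits.step hx' (ih (h.rot_ι hx') hy')

/-- In `B` the rotation leads from the last edge of the corner `T.cornerPerm o` to the edge that
follows the corner `o` in `M`: directly if `o = none`, through one new edge otherwise. New edges are
never last in a corner, so the first hit is not affected. -/
theorem hits_rot_corner_iff (h : CutData T B M ι β γ) (hγ : ∀ t, M.face (γ t) ≠ M.root)
    (o : Option T.Dart) (y : B.Dart) :
    Hits B.rot (Set.range (ι ∘ M.corner γ)) (B.rot (ι (M.corner γ (T.cornerPerm o)))) y ↔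
      Hits B.rot (Set.range (ι ∘ M.corner γ)) (ι (M.rot (M.corner γ o))) y := by
  cases o with
  | none =>
    rw [T.cornerPerm_none, M.rot_corner_none]
    change Hits _ _ (B.rot (ι (γ T.root))) _ ↔ _
    rw [h.rot_ι_γ_root]
  | some s =>
    have hβ : β (T.inv s) ∉ Set.range (ι ∘ M.corner γ) := by
      rintro ⟨o, ho⟩
      exact h.ι_ne_β _ _ ho
    rw [h.rot_ι_corner hγ]
    change _ ↔ Hits _ _ (ι (M.rot (γ s))) _
    rw [← h.rot_β hγ]
    constructor
    · intro hh
      cases hh with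
      | here hx => exact absurd hx hβ
      | step _ hh => exact hh
    · exact Hits.step hβ

/-- The corners of the tree are the corners of `M` if and only if they are distinct vertices
of `B`. -/
theorem firstReturn_iff (h : CutData T B M ι β γ) (hγ : ∀ t, M.face (γ t) ≠ M.root) :
    FirstReturn M.rot T.cornerPerm (M.corner γ) ↔ FirstReturn B.rot 1 (ι ∘ M.corner γ) := by
  constructor
  · intro hM o'
    obtain ⟨o, rfl⟩ := T.cornerPerm.surjective o'
    exact (h.hits_rot_corner_iff hγ o _).2 (h.hits_map (hM o))
  · intro hB o
    exact h.hits_of_hits_map ((h.hits_rot_corner_iff hγ o _).1 (hB (T.cornerPerm o)))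

/-- Off the corners both rotations have the same cycles. At the corners, `M` has the vertices of
`T`, while `B` has one vertex for each of the `Nat.card T.Dart + 1` corners. -/
theorem numCycles_rot (h : CutData T B M ι β γ) (hγ : ∀ t, M.face (γ t) ≠ M.root)
    (hM : FirstReturn M.rot T.cornerPerm (M.corner γ)) :
    numCycles B.rot + numCycles T.rot = numCycles M.rot + (Nat.card T.Dart + 1) := by
  have h1 := hM.numCycles_eq (h.corner_injective hγ)
  have h2 := ((h.firstReturn_iff hγ).1 hM).numCycles_eq
    (h.ι_injective.comp (h.corner_injective hγ))
  have h3 : (cyclesOff M.rot (Set.range (M.corner γ))).ncard =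
      (cyclesOff B.rot (ι '' Set.range (M.corner γ))).ncard := by
    refine ncard_cyclesOff_eq h.ι_injective (fun x hx => h.rot_ι hx) fun y => ?_
    rcases h.cover y with ⟨x, rfl⟩ | ⟨t, rfl⟩
    · exact ⟨x, Perm.SameCycle.refl _ _⟩
    · refine ⟨M.rot (γ (T.inv t)), 1, ?_⟩
      rw [← h.rot_β hγ, T.inv_inv, zpow_one]
  rw [← Set.range_comp] at h3
  rw [numCycles_one, ← h3, Finite.card_option] at h2
  rw [T.numCycles_cornerPerm] at h1
  omega

theorem hits_β (h : CutData T B M ι β γ) (hT : ∀ t, T.face.SameCycle T.root t) (t : T.Dart) :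
    Hits B.face (Set.range ι) (β t) (ι M.root) := by
  rw [h.map_root]
  exact hits_root_of_contour (A := Set.range ι) hT (fun t ⟨x, hx⟩ => h.ι_ne_β x t hx) ⟨_, h.map_root⟩
    h.face_β_root h.face_β t

/-- The only detour through new edges is the one that precedes the root. -/
theorem firstReturn_face (h : CutData T B M ι β γ) (hT : ∀ t, T.face.SameCycle T.root t) :
    FirstReturn B.face M.face ι := by
  intro x
  by_cases hx : M.face x = M.root
  · rw [h.face_last x hx, hx]
    exact h.hits_β hT _
  · rw [h.face_ι x hx]
    exact Hits.here ⟨_, rfl⟩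

theorem numCycles_face (h : CutData T B M ι β γ) (hT : ∀ t, T.face.SameCycle T.root t) :
    numCycles B.face = numCycles M.face := by
  refine (h.firstReturn_face hT).numCycles_eq_of_meets h.ι_injective fun y => ?_
  rcases h.cover y with ⟨x, rfl⟩ | ⟨t, rfl⟩
  · exact ⟨x, Perm.SameCycle.refl _ _⟩
  · exact ⟨_, (h.hits_β hT t).sameCycle⟩

theorem β_mem_boundary (h : CutData T B M ι β γ) (hT : ∀ t, T.face.SameCycle T.root t)
    (t : T.Dart) : β t ∈ B.boundary := by
  have := (h.hits_β hT t).sameCycle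
  rw [h.map_root] at this
  exact this.symm

theorem ι_mem_boundary (h : CutData T B M ι β γ) (hT : ∀ t, T.face.SameCycle T.root t)
    {x : M.Dart} : ι x ∈ B.boundary ↔ x ∈ M.boundary := by
  have := (h.firstReturn_face hT).sameCycle_iff h.ι_injective (y := M.root) (y' := x)
  rwa [h.map_root] at this

/-- The bijection between oriented edges that underlies the cutting. -/
theorem sum_bijective (h : CutData T B M ι β γ) : Function.Bijective (Sum.elim ι β) := by
  constructor
  · rintro (x | t) (x' | t') hxt
    · exact congrArg _ (h.ι_injective hxt)
    · exact absurd hxt (h.ι_ne_β _ _)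
    · exact absurd hxt.symm (h.ι_ne_β _ _)
    · exact congrArg _ (h.β_injective hxt)
  · intro y
    rcases h.cover y with ⟨x, rfl⟩ | ⟨t, rfl⟩
    · exact ⟨Sum.inl x, rfl⟩
    · exact ⟨Sum.inr t, rfl⟩

theorem card_dart (h : CutData T B M ι β γ) :
    Nat.card B.Dart = Nat.card M.Dart + Nat.card T.Dart := by
  rw [← Nat.card_congr (Equiv.ofBijective _ h.sum_bijective), Nat.card_sum]

theorem numCycles_inv (h : CutData T B M ι β γ) :
    numCycles B.inv = numCycles M.inv + numCycles T.inv := by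
  have h1 := h.card_dart
  rw [← two_mul_numCycles B.inv_inv B.inv_ne, ← two_mul_numCycles M.inv_inv M.inv_ne,
    ← two_mul_numCycles T.inv_inv T.inv_ne] at h1
  omega

theorem ncard_boundary (h : CutData T B M ι β γ) (hT : ∀ t, T.face.SameCycle T.root t) :
    B.boundary.ncard = M.boundary.ncard + 2 * numCycles T.inv := by
  have hb : B.boundary = ι '' M.boundary ∪ Set.range β := by
    ext y
    rcases h.cover y with ⟨x, rfl⟩ | ⟨t, rfl⟩
    · rw [h.ι_mem_boundary hT]
      constructor
      · exact fun hx => Or.inl ⟨x, hx, rfl⟩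
      · rintro (⟨x', hx', hxx⟩ | ⟨t, ht⟩)
        · rwa [← h.ι_injective hxx]
        · exact absurd ht.symm (h.ι_ne_β _ _)
    · exact ⟨fun _ => Or.inr ⟨t, rfl⟩, fun _ => h.β_mem_boundary hT t⟩
  have hd : Disjoint (ι '' M.boundary) (Set.range β) := by
    rw [Set.disjoint_left]
    rintro _ ⟨x, -, rfl⟩ ⟨t, ht⟩
    exact h.ι_ne_β _ _ ht.symm
  rw [hb, Set.ncard_union_eq hd (Set.toFinite _) (Set.toFinite _),
    Set.ncard_image_of_injective _ h.ι_injective, ← Nat.card_coe_set_eq (Set.range β),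
    Nat.card_range_of_injective h.β_injective, two_mul_numCycles T.inv_inv T.inv_ne]

end CutData

/-! ### Connectedness, planarity and simplicity of the boundary -/

namespace RotSys

/-- Connectedness, in terms of properties that are constant along the graph. -/
def Connected (M : RotSys) : Prop :=
  ∀ P : M.Dart → Prop, (∀ d, P (M.rot d) ↔ P d) → (∀ d, P (M.inv d) ↔ P d) →
    ∀ d d', P d ↔ P d'

theorem connected_toRotSys (M : RootedMap) : M.toRotSys.Connected := by
  intro P hr hi d d'
  obtain ⟨g, hg, rfl⟩ := M.connected d d'
  have key : ∀ g ∈ Subgroup.closure ({M.rot, M.inv} : Set (Perm M.Dart)), ∀ d, P (g d) ↔ P d := by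
    intro g hg
    induction hg using Subgroup.closure_induction with
    | mem x hx =>
      rcases hx with rfl | hx
      · exact hr
      · rw [Set.mem_singleton_iff] at hx
        subst hx
        exact hi
    | one => exact fun _ => Iff.rfl
    | mul x y _ _ ihx ihy => exact fun d => (ihx _).trans (ihy d)
    | inv x _ ih => exact fun d => by rw [← ih (x⁻¹ d), ← Perm.mul_apply]; simp
  exact (key g hg d).symm

theorem Connected.exists_mem_closure {M : RotSys} (h : M.Connected) (d d' : M.Dart) :
    ∃ g ∈ Subgroup.closure ({M.rot, M.inv} : Set (Perm M.Dart)), g d = d' := by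
  set G := Subgroup.closure ({M.rot, M.inv} : Set (Perm M.Dart)) with hG
  have key : ∀ s ∈ G, ∀ x, (∃ g ∈ G, g d = s x) ↔ ∃ g ∈ G, g d = x := by
    intro s hs x
    constructor
    · rintro ⟨g, hg, hgx⟩
      exact ⟨s⁻¹ * g, G.mul_mem (G.inv_mem hs) hg, by simp [Perm.mul_apply, hgx]⟩
    · rintro ⟨g, hg, rfl⟩
      exact ⟨s * g, G.mul_mem hs hg, rfl⟩
  exact (h (fun x => ∃ g ∈ G, g d = x) (key _ (Subgroup.subset_closure (by simp)))
    (key _ (Subgroup.subset_closure (by simp))) d d').1 ⟨1, G.one_mem, rfl⟩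

/-- A property that is constant along the contours of the faces and along the edges. -/
theorem Connected.of_face {M : RotSys} (h : M.Connected) {P : M.Dart → Prop}
    (hf : ∀ d, P (M.face d) ↔ P d) (hi : ∀ d, P (M.inv d) ↔ P d) (d d' : M.Dart) :
    P d ↔ P d' :=
  h P (fun d => by rw [← M.face_inv, hf, hi]) hi d d'

theorem iff_of_sameCycle {X : Type*} {σ : Perm X} {P : X → Prop} (h : ∀ x, P (σ x) ↔ P x)
    [Finite X] {x y : X} (hxy : σ.SameCycle x y) : P x ↔ P y := by
  obtain ⟨k, rfl⟩ := hxy.exists_nat_pow_eq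
  clear hxy
  induction k with
  | zero => exact Iff.rfl
  | succ k ih => rw [pow_succ', Perm.mul_apply, h]; exact ih

/-- Euler's relation. -/
def Planar (M : RotSys) : Prop :=
  numCycles M.rot + numCycles M.face = numCycles M.inv + 2

/-- A connected planar rotation system is a rooted map. -/
def toRootedMap (M : RotSys) (hc : M.Connected) (hp : M.Planar) : RootedMap :=
  ⟨M.Dart, M.finite_dart, M.rot, M.inv, M.inv_inv, M.inv_ne, M.root, hc.exists_mem_closure, hp⟩

/-- The contour of the external face visits no vertex twice. -/
def Simple (M : RotSys) : Prop :=
  ∀ d ∈ M.boundary, ∀ d' ∈ M.boundary, M.rot.SameCycle d d' → d = d'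

/-- `M.face d` starts where `M.inv d` does. If both sides of an edge were on the simple boundary,
`M.face` would exchange them, and the boundary would have length 2. -/
theorem Simple.inv_notMem {M : RotSys} (hM : M.Simple) (h3 : 3 ≤ M.boundary.ncard) {d : M.Dart}
    (hd : d ∈ M.boundary) : M.inv d ∉ M.boundary := by
  intro hi
  have h1 : M.face d = M.inv d :=
    hM _ (M.face_mem_boundary hd) _ hi ⟨-1, by simp [face_apply]⟩
  have h2 : M.face (M.inv d) = d :=
    hM _ (M.face_mem_boundary hi) _ hd ⟨-1, by simp [face_inv]⟩
  have h4 : M.boundary ⊆ {d, M.inv d} := by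
    intro x hx
    have h5 : M.face.SameCycle d x := Perm.SameCycle.trans (Perm.SameCycle.symm hd) hx
    obtain ⟨k, rfl⟩ := h5.exists_nat_pow_eq
    clear hx h5
    induction k with
    | zero => exact Or.inl rfl
    | succ k ih =>
      rw [pow_succ', Perm.mul_apply]
      rcases ih with ih | ih
      · rw [ih, h1]; exact Or.inr rfl
      · rw [ih, h2]; exact Or.inl rfl
  have h5 := (Set.ncard_le_ncard h4).trans (Set.ncard_insert_le _ _)
  rw [Set.ncard_singleton] at h5
  omega

end RotSys

namespace CutData

variable {T B M : RotSys} {ι : M.Dart → B.Dart} {β : T.Dart → B.Dart} {γ : T.Dart → M.Dart}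

/-- A property that is constant along contours and edges of `B` is constant on the external contour,
hence on all `β t` and on their opposites `ι (γ t)`. So it does not notice that the edges of the
tree have been cut. -/
theorem connected_cut (h : CutData T B M ι β γ) (hT : ∀ t, T.face.SameCycle T.root t)
    (hM : M.Connected) : B.Connected := by
  intro Q hr hi
  have hf : ∀ d, Q (B.face d) ↔ Q d := fun d => by rw [B.face_apply, hr, hi]
  have hb : ∀ d ∈ B.boundary, (Q B.root ↔ Q d) := fun d hd => RotSys.iff_of_sameCycle hf hd
  have hβ : ∀ t, Q B.root ↔ Q (β t) := fun t => hb _ (h.β_mem_boundary hT t)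
  have hγ : ∀ t, Q B.root ↔ Q (ι (γ t)) := fun t => by rw [hβ t, ← h.inv_β, hi]
  have hι : ∀ x, Q B.root ↔ Q (ι x) := by
    intro x
    rw [← h.map_root]
    refine hM.of_face (P := fun x => Q (ι x)) (fun x => ?_) (fun x => ?_) _ _
    · by_cases hx : M.face x = M.root
      · rw [hx, h.map_root, hβ, ← h.face_last x hx, hf]
      · rw [← h.face_ι x hx, hf]
    · by_cases hx : x ∈ Set.range γ
      · obtain ⟨t, rfl⟩ := hx
        rw [← h.map_inv, ← hγ, ← hγ]
      · rw [← h.inv_ι x hx, hi]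
  have hy : ∀ y, Q B.root ↔ Q y := by
    intro y
    rcases h.cover y with ⟨x, rfl⟩ | ⟨t, rfl⟩
    · exact hι x
    · exact hβ t
  exact fun y y' => (hy y).symm.trans (hy y')

theorem firstReturn_γ (h : CutData T B M ι β γ) (hγ : ∀ t, M.face (γ t) ≠ M.root)
    (hM : FirstReturn M.rot T.cornerPerm (M.corner γ)) : FirstReturn M.rot T.rot γ :=
  hM.comp (h.corner_injective hγ) T.firstReturn_cornerPerm

theorem hits_root (hM : FirstReturn M.rot T.cornerPerm (M.corner γ)) :
    Hits M.rot (Set.range (M.corner γ)) M.root (γ T.root) := by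
  have := hM none
  rwa [M.rot_corner_none, T.cornerPerm_none] at this

theorem connected_glued (h : CutData T B M ι β γ) (hγ : ∀ t, M.face (γ t) ≠ M.root)
    (hM : FirstReturn M.rot T.cornerPerm (M.corner γ)) (hT : T.Connected) (hB : B.Connected) :
    M.Connected := by
  intro P hr hi
  have hf : ∀ d, P (M.face d) ↔ P d := fun d => by rw [M.face_apply, hr, hi]
  have hPγ : ∀ t, P M.root ↔ P (γ t) := by
    intro t
    rw [RotSys.iff_of_sameCycle hr (hits_root hM).sameCycle]
    refine hT (fun t => P (γ t)) (fun t => ?_) (fun t => ?_) _ _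
    · exact (RotSys.iff_of_sameCycle hr ((h.firstReturn_γ hγ hM).sameCycle_apply t)).symm
    · rw [h.map_inv, hi]
  let e := Equiv.ofBijective _ h.sum_bijective
  -- New edges receive the value at the root, which is also the value on the tree, as `T` is
  -- connected and attached to the root vertex.
  let Q : B.Dart → Prop := fun y => Sum.elim P (fun _ => P M.root) (e.symm y)
  have hQι : ∀ x, Q (ι x) ↔ P x := by
    intro x
    have : e.symm (ι x) = Sum.inl x := by rw [Equiv.symm_apply_eq]; rfl
    simp [Q, this]
  have hQβ : ∀ t, Q (β t) ↔ P M.root := by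
    intro t
    have : e.symm (β t) = Sum.inr t := by rw [Equiv.symm_apply_eq]; rfl
    simp [Q, this]
  intro x x'
  rw [← hQι, ← hQι]
  refine hB.of_face (fun y => ?_) (fun y => ?_) _ _
  · rcases h.cover y with ⟨x, rfl⟩ | ⟨t, rfl⟩
    · by_cases hx : M.face x = M.root
      · rw [h.face_last x hx, hQβ, hQι, ← hf x, hx]
      · rw [h.face_ι x hx, hQι, hQι, hf]
    · by_cases ht : t = T.root
      · rw [ht, h.face_β_root, ← h.map_root, hQι, hQβ]
      · obtain ⟨t, rfl⟩ := T.face.surjective t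
        rw [h.face_β t ht, hQβ, hQβ]
  · rcases h.cover y with ⟨x, rfl⟩ | ⟨t, rfl⟩
    · by_cases hx : x ∈ Set.range γ
      · obtain ⟨t, rfl⟩ := hx
        rw [h.inv_ι_γ, hQβ, hQι, hPγ]
      · rw [h.inv_ι x hx, hQι, hQι, hi]
    · rw [h.inv_β, hQι, hQβ, hPγ]

/-- A tree has one vertex more than edges. By `numCycles_rot`, cutting along `m` edges therefore
adds `m` vertices, as well as `m` edges and no face. -/
theorem planar_iff (h : CutData T B M ι β γ) (hγ : ∀ t, M.face (γ t) ≠ M.root)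
    (hM : FirstReturn M.rot T.cornerPerm (M.corner γ)) (hT : ∀ t, T.face.SameCycle T.root t)
    (hTp : T.Planar) (hTf : numCycles T.face = 1) : B.Planar ↔ M.Planar := by
  have h1 := h.numCycles_rot hγ hM
  have h2 := h.numCycles_face hT
  have h3 := h.numCycles_inv
  rw [← two_mul_numCycles T.inv_inv T.inv_ne] at h1
  unfold RotSys.Planar at *
  omega

theorem ι_rot_corner_mem_boundary (h : CutData T B M ι β γ)
    (hT : ∀ t, T.face.SameCycle T.root t) (hγ : ∀ t, M.face (γ t) ≠ M.root) (o : Option T.Dart) :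
    B.rot (ι (M.corner γ o)) ∈ B.boundary := by
  obtain ⟨o, rfl⟩ := T.cornerPerm.surjective o
  cases o with
  | none =>
    rw [T.cornerPerm_none]
    change B.rot (ι (γ T.root)) ∈ _
    rw [h.rot_ι_γ_root, h.map_root]
    exact B.root_mem_boundary
  | some s =>
    rw [h.rot_ι_corner hγ]
    exact h.β_mem_boundary hT _

/-- In `B` the edge that follows the last edge of a corner is on the boundary. Two corners at the
same vertex of `B` would be two visits of the boundary to this vertex. -/
theorem firstReturn_of_simple (h : CutData T B M ι β γ)
    (hT : ∀ t, T.face.SameCycle T.root t) (hγ : ∀ t, M.face (γ t) ≠ M.root) (hB : B.Simple) :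
    FirstReturn M.rot T.cornerPerm (M.corner γ) := by
  rw [h.firstReturn_iff hγ]
  intro o
  have hs : B.rot.SameCycle (B.rot ((ι ∘ M.corner γ) o)) ((ι ∘ M.corner γ) o) := ⟨-1, by simp⟩
  obtain ⟨z, hz⟩ := Hits.exists_of_sameCycle hs (Set.mem_range_self (f := ι ∘ M.corner γ) o)
  obtain ⟨o', rfl⟩ := hz.mem
  have h1 := hB _ (h.ι_rot_corner_mem_boundary hT hγ o) _ (h.ι_rot_corner_mem_boundary hT hγ o')
    (Perm.SameCycle.trans hz.sameCycle ⟨1, by simp⟩)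
  rwa [h.corner_injective hγ (h.ι_injective (B.rot.injective h1))] at hz ⊢

/-- Turn from `d` to the last edge of its corner. In `B`, the next edge and `ι d` are boundary edges
at the same vertex, so they coincide; as `ι d` is not a new edge, it is the root. -/
theorem eq_root_of_sameCycle_corner (h : CutData T B M ι β γ)
    (hT : ∀ t, T.face.SameCycle T.root t) (hγ : ∀ t, M.face (γ t) ≠ M.root) (hB : B.Simple)
    {d : M.Dart} (hd : d ∈ M.boundary) {o : Option T.Dart}
    (ho : M.rot.SameCycle d (M.corner γ o)) : d = M.root := by
  obtain ⟨z, hz⟩ := Hits.exists_of_sameCycle ho (Set.mem_range_self o)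
  obtain ⟨o, rfl⟩ := hz.mem
  have h1 := hB _ ((h.ι_mem_boundary hT).2 hd) _ (h.ι_rot_corner_mem_boundary hT hγ o)
    (Perm.SameCycle.trans (h.hits_map hz).sameCycle ⟨1, by simp⟩)
  obtain ⟨o, rfl⟩ := T.cornerPerm.surjective o
  cases o with
  | none =>
    rw [T.cornerPerm_none] at h1
    exact h.ι_injective (h1.trans h.rot_ι_γ_root)
  | some s =>
    rw [h.rot_ι_corner hγ] at h1
    exact absurd h1 (h.ι_ne_β _ _)

theorem simple_glued (h : CutData T B M ι β γ) (hT : ∀ t, T.face.SameCycle T.root t)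
    (hγ : ∀ t, M.face (γ t) ≠ M.root) (hB : B.Simple) : M.Simple := by
  intro d hd d' hd' hs
  by_cases ht : ∃ o, M.rot.SameCycle d (M.corner γ o)
  · obtain ⟨o, ho⟩ := ht
    rw [h.eq_root_of_sameCycle_corner hT hγ hB hd ho,
      h.eq_root_of_sameCycle_corner hT hγ hB hd' (hs.symm.trans ho)]
  · push Not at ht
    refine h.ι_injective (hB _ ((h.ι_mem_boundary hT).2 hd) _ ((h.ι_mem_boundary hT).2 hd') ?_)
    refine (sameCycle_map_iff_of_agree (ι := ι) (A := Set.range (M.corner γ))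
        (fun x hx => h.rot_ι hx) h.ι_injective ?_).2 hs
    rintro _ ⟨o, rfl⟩
    exact ht o

theorem simple_cut (h : CutData T B M ι β γ) (hT : ∀ t, T.face.SameCycle T.root t)
    (hγ : ∀ t, M.face (γ t) ≠ M.root)
    (hF : FirstReturn M.rot T.cornerPerm (M.corner γ)) (hM : M.Simple)
    (hr : ∀ t, ∀ b ∈ M.boundary, M.rot.SameCycle (γ t) b → b = M.root) : B.Simple := by
  rw [h.firstReturn_iff hγ] at hF
  -- A boundary edge of `B` follows the last edge of a corner, or comes from a boundary vertex of
  -- `M` off the tree. The first kind is separated by `hF`, the second by the simplicity of `M`.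
  have hcase : ∀ d ∈ B.boundary, (∃ o, B.rot (ι (M.corner γ o)) = d) ∨
      ∃ x ∈ M.boundary, ι x = d ∧ ∀ a ∈ Set.range (M.corner γ), ¬ M.rot.SameCycle x a := by
    intro d hd
    rcases h.cover d with ⟨x, rfl⟩ | ⟨t, rfl⟩
    · by_cases hx : x = M.root
      · subst hx
        exact Or.inl ⟨some T.root, h.rot_ι_γ_root⟩
      · refine Or.inr ⟨x, (h.ι_mem_boundary hT).1 hd, rfl, ?_⟩
        rintro _ ⟨o, rfl⟩ hs
        cases o with
        | none =>
          refine hx (hM _ ((h.ι_mem_boundary hT).1 hd) _ M.root_mem_boundary ?_)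
          exact hs.trans ⟨1, by rw [zpow_one, M.rot_corner_none]⟩
        | some t => exact hx (hr t x ((h.ι_mem_boundary hT).1 hd) hs.symm)
    · refine Or.inl ⟨_, (h.rot_ι_corner hγ (T.inv t)).trans (by rw [T.inv_inv])⟩
  have hdisj : ∀ x, (∀ a ∈ Set.range (M.corner γ), ¬ M.rot.SameCycle x a) →
      ∀ o, ¬ B.rot.SameCycle (ι x) (B.rot (ι (M.corner γ o))) := by
    intro x hx o hs
    refine not_sameCycle_of_agree (ι := ι) (A := Set.range (M.corner γ))
        (fun x hx => h.rot_ι hx) h.ι_injective hx _ ⟨o, rfl⟩ ?_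
    exact hs.trans ⟨-1, by simp⟩
  intro d hd d' hd' hs
  rcases hcase d hd with ⟨o, rfl⟩ | ⟨x, -, rfl, hx⟩
  · rcases hcase d' hd' with ⟨o', rfl⟩ | ⟨x', -, rfl, hx'⟩
    · have h1 : B.rot.SameCycle ((ι ∘ M.corner γ) o) ((ι ∘ M.corner γ) o') :=
        Perm.SameCycle.trans ⟨1, by simp⟩ (hs.trans ⟨-1, by simp⟩)
      obtain ⟨k, hk⟩ := hF.sameCycle_of_sameCycle (h.ι_injective.comp (h.corner_injective hγ)) h1
      rw [one_zpow, Perm.one_apply] at hk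
      rw [hk]
    · exact absurd hs.symm (hdisj x' hx' o)
  · rcases hcase d' hd' with ⟨o', rfl⟩ | ⟨x', hxb', rfl, hx'⟩
    · exact absurd hs (hdisj x hx o')
    · rw [hM x ((h.ι_mem_boundary hT).1 hd) x' hxb'
        ((sameCycle_map_iff_of_agree (ι := ι) (A := Set.range (M.corner γ))
        (fun x hx => h.rot_ι hx) h.ι_injective hx).1 hs)]

/-- The corners of a subtree of `M`, if its root corner is the one of the external face. -/
theorem firstReturn_corner (h : CutData T B M ι β γ) (hγ : ∀ t, M.face (γ t) ≠ M.root)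
    (hF : FirstReturn M.rot T.rot γ) (hr : Hits M.rot (Set.range γ) M.root (γ T.root)) :
    FirstReturn M.rot T.cornerPerm (M.corner γ) := by
  have hz := h.corner_none_notMem hγ
  have hr' : Hits M.rot (Set.range (M.corner γ)) M.root (γ T.root) := by
    obtain ⟨z, hz1, hz2⟩ := Hits.exists_insert_inv hr.sameCycle hr.mem
    rwa [M.range_corner, hr.unique hz1]
  rintro (_ | t)
  · rwa [M.rot_corner_none, T.cornerPerm_none]
  · change Hits _ _ (M.rot (γ t)) _
    -- If the turn from `γ t` to the next edge of the tree crosses `M.rot⁻¹ M.root`, then this next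
    -- edge is the first one after `M.root`, which is `γ T.root`.
    rcases (hF t).insert_or hz with ⟨h1, h2⟩ | h1
    · rw [← Perm.mul_apply, mul_inv_cancel, Perm.one_apply] at h2
      rw [T.cornerPerm_some_of_eq (h.γ_injective (h2.unique hr)), M.range_corner]
      exact h1
    · rw [← M.range_corner] at h1
      by_cases ht : T.rot t = T.root
      · rw [ht] at h1
        -- Without such a crossing, `γ t` and `M.rot⁻¹ M.root` would have the same first return `γ
        -- T.root`.
        have h3 := Hits.return_injective (A := Set.range (M.corner γ)) (a := γ t)
          (a' := M.rot⁻¹ M.root)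
          ⟨some t, rfl⟩ ⟨none, rfl⟩ h1 (by simpa using hr')
        exact absurd ⟨t, h3⟩ hz
      · rwa [T.cornerPerm_some_of_ne ht]

end CutData

/-! ### Existence and uniqueness of the glued map and of the cut map -/

/-- The gluing of `T` to `B`, as a rotation system. -/
theorem exists_glued {T B : RotSys} {β : T.Dart → B.Dart} (hT : ∀ t, T.face.SameCycle T.root t)
    (hinj : Function.Injective β) (hroot : B.root ∉ Set.range β)
    (hinv : ∀ t, B.inv (β t) ∉ Set.range β) (hβr : B.face (β T.root) = B.root)
    (hβ : ∀ t, T.face t ≠ T.root → B.face (β (T.face t)) = β t) :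
    ∃ (M : RotSys) (ι : M.Dart → B.Dart) (γ : T.Dart → M.Dart), CutData T B M ι β γ := by
  let X := {y : B.Dart // y ∉ Set.range β}
  let ι : X → B.Dart := Subtype.val
  have hι : Function.Injective ι := Subtype.val_injective
  obtain ⟨φ, hφ⟩ := FirstReturn.exists_perm B.face hι
  have hβι : ∀ t, β t ∉ Set.range ι := fun t ⟨x, hx⟩ => x.2 ⟨t, hx.symm⟩
  -- The opposite edge in the glued map: if `x` is opposite to `β t`, it plays the part of `γ t`,
  -- and its partner is the opposite of `β (T.inv t)`. Other edges keep their partner.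
  have hα : ∀ x : X, ∃ x' : X, (∀ t, B.inv (ι x) = β t → ι x' = B.inv (β (T.inv t))) ∧
      ((∀ t, B.inv (ι x) ≠ β t) → ι x' = B.inv (ι x)) := by
    intro x
    by_cases hx : ∃ t, B.inv (ι x) = β t
    · obtain ⟨t, ht⟩ := hx
      refine ⟨⟨_, hinv (T.inv t)⟩, fun t' ht' => ?_, fun hn => absurd ht (hn t)⟩
      rw [hinj (ht.symm.trans ht')]
    · push Not at hx
      exact ⟨⟨B.inv (ι x), fun ⟨t, ht⟩ => hx t ht.symm⟩, fun t ht => absurd ht (hx t), fun _ => rfl⟩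
  choose α hα1 hα2 using hα
  have hαα : Function.Involutive α := by
    intro x
    apply hι
    by_cases hx : ∃ t, B.inv (ι x) = β t
    · obtain ⟨t, ht⟩ := hx
      rw [hα1 (α x) (T.inv t) (by rw [hα1 x t ht, B.inv_inv]), T.inv_inv, ← ht, B.inv_inv]
    · push Not at hx
      have h1 := hα2 x hx
      rw [hα2 (α x), h1, B.inv_inv]
      intro t ht
      rw [h1, B.inv_inv] at ht
      exact hβι t ⟨x, ht⟩
  have hne : ∀ x, α x ≠ x := by
    intro x hxx
    by_cases hx : ∃ t, B.inv (ι x) = β t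
    · obtain ⟨t, ht⟩ := hx
      have h1 := hα1 x t ht
      rw [hxx] at h1
      rw [h1, B.inv_inv] at ht
      exact T.inv_ne t (hinj ht)
    · push Not at hx
      have h1 := hα2 x hx
      rw [hxx] at h1
      exact B.inv_ne _ h1.symm
  let α' : Perm X := hαα.toPerm
  have hα' : ∀ x, α' x = α x := fun _ => rfl
  -- With the rotation `φ * α'`, the contours are the cycles of `φ`, that is, those of `B` without
  -- the new edges.
  let M : RotSys := ⟨X, inferInstance, φ * α', α', hαα, hne, ⟨B.root, hroot⟩⟩
  have hf : ∀ x, M.face x = φ x := fun x => congrArg φ (hαα x)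
  refine ⟨M, ι, fun t => ⟨B.inv (β t), hinv t⟩, hι, hinj, fun x t ht => hβι t ⟨x, ht⟩, ?_, rfl,
    ?_, ?_, hβr, hβ, fun t => rfl, ?_, ?_⟩
  · intro y
    by_cases hy : y ∈ Set.range β
    · exact Or.inr hy
    · exact Or.inl ⟨⟨y, hy⟩, rfl⟩
  · intro x hx
    rw [hf] at hx ⊢
    by_cases hy : B.face (ι x) ∈ Set.range β
    · obtain ⟨t, ht⟩ := hy
      have h1 := hφ x
      rw [← ht] at h1
      exact absurd (hι (h1.unique (hits_root_of_contour hT hβι ⟨M.root, rfl⟩ hβr hβ t))) hx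
    · exact (hφ x).eq_of_mem ⟨⟨_, hy⟩, rfl⟩
  · intro x hx
    rw [hf] at hx
    by_cases hy : B.face (ι x) ∈ Set.range β
    · obtain ⟨t, ht⟩ := hy
      by_cases hr : T.face t = T.root
      · rw [← ht, ← hr]
        simp
      · rw [← hβ t hr] at ht
        exact absurd ⟨x, B.face.injective ht.symm⟩ (hβι (T.face t))
    · have h1 := (hφ x).eq_of_mem ⟨⟨_, hy⟩, rfl⟩
      rw [hx] at h1
      exact absurd ⟨x, B.face.injective (h1.trans hβr.symm)⟩ (hβι T.root)
  · intro x hx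
    refine (hα2 x fun t ht => hx ⟨t, ?_⟩).symm
    apply hι
    change B.inv (β t) = _
    rw [← ht, B.inv_inv]
  · intro t
    apply hι
    exact (hα1 _ t (B.inv_inv _)).symm

/-- The map obtained by cutting `M` along the tree `γ`, as a rotation system. -/
theorem exists_cut {T M : RotSys} {γ : T.Dart → M.Dart} (hinj : Function.Injective γ)
    (hinv : ∀ t, γ (T.inv t) = M.inv (γ t)) :
    ∃ (B : RotSys) (ι : M.Dart → B.Dart) (β : T.Dart → B.Dart), CutData T B M ι β γ := by
  classical
  have hg : ∀ x : M.Dart, ∃ y : M.Dart ⊕ T.Dart, (∀ t, x = γ t → y = Sum.inr t) ∧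
      (x ∉ Set.range γ → y = Sum.inl (M.inv x)) := by
    intro x
    by_cases hx : x ∈ Set.range γ
    · obtain ⟨t, rfl⟩ := hx
      exact ⟨Sum.inr t, fun t' ht' => by rw [hinj ht'], fun hn => absurd ⟨t, rfl⟩ hn⟩
    · exact ⟨Sum.inl (M.inv x), fun t ht => absurd ⟨t, ht.symm⟩ hx, fun _ => rfl⟩
  choose g hg1 hg2 using hg
  let α : M.Dart ⊕ T.Dart → M.Dart ⊕ T.Dart := Sum.elim g fun t => Sum.inl (γ t)
  have hnot : ∀ x, x ∉ Set.range γ → M.inv x ∉ Set.range γ := by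
    rintro x hx ⟨t, ht⟩
    exact hx ⟨T.inv t, by rw [hinv, ht, M.inv_inv]⟩
  have hαα : Function.Involutive α := by
    rintro (x | t)
    · by_cases hx : x ∈ Set.range γ
      · obtain ⟨t, rfl⟩ := hx
        change α (g (γ t)) = _
        rw [hg1 _ t rfl]
        rfl
      · change α (g x) = _
        rw [hg2 x hx]
        change g (M.inv x) = _
        rw [hg2 _ (hnot x hx), M.inv_inv]
    · exact hg1 _ t rfl
  have hne : ∀ y, α y ≠ y := by
    rintro (x | t)
    · change g x ≠ _
      by_cases hx : x ∈ Set.range γ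
      · obtain ⟨t, rfl⟩ := hx
        rw [hg1 _ t rfl]
        exact Sum.inr_ne_inl
      · rw [hg2 x hx]
        exact fun h => M.inv_ne x (Sum.inl_injective h)
    · exact Sum.inl_ne_inr
  let α' : Perm (M.Dart ⊕ T.Dart) := hαα.toPerm
  -- The transposition merges two cycles: the predecessor of `M.root` now leads to `T.face⁻¹
  -- T.root`, and `T.root`, the end of the reversed contour, leads to `M.root`.
  let s : Perm (M.Dart ⊕ T.Dart) := swap (Sum.inl M.root) (Sum.inr (T.face⁻¹ T.root))
  let φ : Perm (M.Dart ⊕ T.Dart) := s * sumCongr M.face T.face⁻¹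
  let B : RotSys := ⟨M.Dart ⊕ T.Dart, inferInstance, φ * α', α', hαα, hne, Sum.inl M.root⟩
  have hf : ∀ y, B.face y = φ y := fun y => congrArg φ (hαα y)
  refine ⟨B, Sum.inl, Sum.inr, Sum.inl_injective, Sum.inr_injective, fun _ _ => Sum.inl_ne_inr,
    ?_, rfl, ?_, ?_, ?_, ?_, fun t => rfl, fun x hx => hg2 x hx, hinv⟩
  · rintro (x | t)
    · exact Or.inl ⟨x, rfl⟩
    · exact Or.inr ⟨t, rfl⟩
  · intro x hx
    rw [hf]
    exact swap_apply_of_ne_of_ne (fun h => hx (Sum.inl_injective h)) Sum.inl_ne_inr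
  · intro x hx
    rw [hf]
    change s (Sum.inl (M.face x)) = _
    rw [hx]
    exact swap_apply_left _ _
  · rw [hf]
    change s (Sum.inr (T.face⁻¹ T.root)) = _
    exact swap_apply_right _ _
  · intro t ht
    rw [hf]
    change s (Sum.inr (T.face⁻¹ (T.face t))) = _
    rw [← Perm.mul_apply, inv_mul_cancel, Perm.one_apply]
    refine swap_apply_of_ne_of_ne Sum.inr_ne_inl fun h => ht ?_
    rw [Sum.inr_injective h]
    simp

namespace CutData

/-- `face_β_root` and `face_β` determine `β` by going backwards along the contour of `B` from the
root. -/
theorem β_unique {T B M M' : RotSys} {ι : M.Dart → B.Dart} {β β' : T.Dart → B.Dart}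
    {γ : T.Dart → M.Dart} {ι' : M'.Dart → B.Dart} {γ' : T.Dart → M'.Dart}
    (h : CutData T B M ι β γ) (h' : CutData T B M' ι' β' γ')
    (hT : ∀ t, T.face.SameCycle T.root t) : β = β' := by
  funext t
  have h0 : β T.root = β' T.root :=
    B.face.injective (h.face_β_root.trans h'.face_β_root.symm)
  obtain ⟨k, rfl⟩ := (hT t).exists_nat_pow_eq
  clear hT
  induction k with
  | zero => exact h0
  | succ k ih =>
    rw [pow_succ', Perm.mul_apply]
    by_cases hr : T.face ((T.face ^ k) T.root) = T.root
    · rw [hr, h0]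
    · exact B.face.injective ((h.face_β _ hr).trans (ih.trans (h'.face_β _ hr).symm))

/-- The glued map is determined by `T` and `B`. -/
theorem glued_unique {T B M M' : RotSys} {ι : M.Dart → B.Dart} {β β' : T.Dart → B.Dart}
    {γ : T.Dart → M.Dart} {ι' : M'.Dart → B.Dart} {γ' : T.Dart → M'.Dart}
    (h : CutData T B M ι β γ) (h' : CutData T B M' ι' β' γ')
    (hT : ∀ t, T.face.SameCycle T.root t) :
    ∃ e : M.Dart ≃ M'.Dart, (∀ d, e (M.rot d) = M'.rot (e d)) ∧
      (∀ d, e (M.inv d) = M'.inv (e d)) ∧ e M.root = M'.root ∧ ∀ t, e (γ t) = γ' t := by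
  obtain rfl := h.β_unique h' hT
  have hf : ∀ x, ∃ x', ι' x' = ι x := fun x =>
    (h'.cover (ι x)).resolve_right fun ⟨t, ht⟩ => h.ι_ne_β x t ht.symm
  have hg : ∀ x', ∃ x, ι x = ι' x' := fun x =>
    (h.cover (ι' x)).resolve_right fun ⟨t, ht⟩ => h'.ι_ne_β x t ht.symm
  choose f hf using hf
  choose g hg using hg
  let e : M.Dart ≃ M'.Dart := ⟨f, g, fun x => h.ι_injective (by rw [hg, hf]),
    fun x => h'.ι_injective (by rw [hf, hg])⟩
  have he : ∀ x, ι' (e x) = ι x := hf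
  have hγ : ∀ t, e (γ t) = γ' t := fun t =>
    h'.ι_injective (by rw [he, ← h.inv_β, ← h'.inv_β])
  have hroot : e M.root = M'.root := h'.ι_injective (by rw [he, h.map_root, h'.map_root])
  have hinv : ∀ d, e (M.inv d) = M'.inv (e d) := by
    intro d
    by_cases hd : d ∈ Set.range γ
    · obtain ⟨t, rfl⟩ := hd
      rw [← h.map_inv, hγ, hγ, h'.map_inv]
    · have hd' : e d ∉ Set.range γ' := by
        rintro ⟨t, ht⟩
        exact hd ⟨t, e.injective ((hγ t).trans ht)⟩
      apply h'.ι_injective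
      rw [he, ← h.inv_ι d hd, ← h'.inv_ι _ hd', he]
  have hface : ∀ d, e (M.face d) = M'.face (e d) := by
    intro d
    by_cases hd : M.face d = M.root
    · by_cases hd' : M'.face (e d) = M'.root
      · rw [hd, hd', hroot]
      · have h1 := h'.face_ι _ hd'
        rw [he, h.face_last d hd] at h1
        exact absurd h1.symm (h'.ι_ne_β _ _)
    · by_cases hd' : M'.face (e d) = M'.root
      · have h1 := h'.face_last _ hd'
        rw [he, h.face_ι d hd] at h1
        exact absurd h1 (h.ι_ne_β _ _)
      · apply h'.ι_injective
        rw [he, ← h.face_ι d hd, ← h'.face_ι _ hd', he]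
  exact ⟨e, fun d => by rw [← M.face_inv, hface, hinv, M'.face_inv], hinv, hroot, hγ⟩

/-- The cut map is determined by `M` and the tree. -/
theorem cut_unique {T T' B B' M : RotSys} {ι : M.Dart → B.Dart} {β : T.Dart → B.Dart}
    {γ : T.Dart → M.Dart} {ι' : M.Dart → B'.Dart} {β' : T'.Dart → B'.Dart}
    {γ' : T'.Dart → M.Dart} (h : CutData T B M ι β γ) (h' : CutData T' B' M ι' β' γ')
    (θ : T.Dart ≃ T'.Dart) (hθr : ∀ t, θ (T.rot t) = T'.rot (θ t))
    (hθi : ∀ t, θ (T.inv t) = T'.inv (θ t)) (hθ : θ T.root = T'.root)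
    (hθγ : ∀ t, γ' (θ t) = γ t) :
    ∃ e : B.Dart ≃ B'.Dart, (∀ d, e (B.rot d) = B'.rot (e d)) ∧
      (∀ d, e (B.inv d) = B'.inv (e d)) ∧ e B.root = B'.root := by
  let E := Equiv.ofBijective _ h.sum_bijective
  let E' := Equiv.ofBijective _ h'.sum_bijective
  let e : B.Dart ≃ B'.Dart := E.symm.trans ((sumCongr (Equiv.refl _) θ).trans E')
  have heι : ∀ x, e (ι x) = ι' x := by
    intro x
    have : E.symm (ι x) = Sum.inl x := by rw [Equiv.symm_apply_eq]; rfl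
    simp only [e, Equiv.trans_apply, this]
    rfl
  have heβ : ∀ t, e (β t) = β' (θ t) := by
    intro t
    have : E.symm (β t) = Sum.inr t := by rw [Equiv.symm_apply_eq]; rfl
    simp only [e, Equiv.trans_apply, this]
    rfl
  have hθf : ∀ t, θ (T.face t) = T'.face (θ t) := fun t => by
    rw [T.face_apply, hθr, hθi, T'.face_apply]
  have hinv : ∀ d, e (B.inv d) = B'.inv (e d) := by
    intro d
    rcases h.cover d with ⟨x, rfl⟩ | ⟨t, rfl⟩
    · by_cases hx : x ∈ Set.range γ
      · obtain ⟨t, rfl⟩ := hx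
        rw [h.inv_ι_γ, heβ, heι, ← hθγ, h'.inv_ι_γ]
      · have hx' : x ∉ Set.range γ' := by
          rintro ⟨t', rfl⟩
          exact hx ⟨θ.symm t', by rw [← hθγ, Equiv.apply_symm_apply]⟩
        rw [h.inv_ι x hx, heι, heι, h'.inv_ι x hx']
    · rw [h.inv_β, heι, heβ, h'.inv_β, hθγ]
  have hface : ∀ d, e (B.face d) = B'.face (e d) := by
    intro d
    rcases h.cover d with ⟨x, rfl⟩ | ⟨t, rfl⟩
    · by_cases hx : M.face x = M.root
      · rw [h.face_last x hx, heβ, heι, h'.face_last x hx]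
        congr 1
        rw [Perm.eq_inv_iff_eq, ← hθf, ← hθ]
        simp
      · rw [h.face_ι x hx, heι, heι, h'.face_ι x hx]
    · by_cases ht : t = T.root
      · rw [ht, h.face_β_root, ← h.map_root, heι, heβ, hθ, h'.face_β_root, h'.map_root]
      · obtain ⟨t, rfl⟩ := T.face.surjective t
        rw [h.face_β t ht, heβ, heβ, hθf, h'.face_β]
        rw [← hθf, ← hθ]
        exact fun hn => ht (θ.injective hn)
  exact ⟨e, fun d => by rw [← B.face_inv, hface, hinv, B'.face_inv], hinv,
    by rw [← h.map_root, heι, h'.map_root]⟩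

end CutData

/-- A planted tree is determined by its image in a map. -/
theorem subtree_unique {T T' M : RotSys} {γ : T.Dart → M.Dart} {γ' : T'.Dart → M.Dart}
    (hγ : Function.Injective γ) (hγ' : Function.Injective γ')
    (hi : ∀ t, γ (T.inv t) = M.inv (γ t)) (hi' : ∀ t, γ' (T'.inv t) = M.inv (γ' t))
    (hF : FirstReturn M.rot T.rot γ) (hF' : FirstReturn M.rot T'.rot γ')
    (hS : Set.range γ = Set.range γ') (hr : Hits M.rot (Set.range γ) M.root (γ T.root))
    (hr' : Hits M.rot (Set.range γ') M.root (γ' T'.root)) :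
    ∃ θ : T.Dart ≃ T'.Dart, (∀ t, θ (T.rot t) = T'.rot (θ t)) ∧
      (∀ t, θ (T.inv t) = T'.inv (θ t)) ∧ θ T.root = T'.root ∧ ∀ t, γ' (θ t) = γ t := by
  let θ : T.Dart ≃ T'.Dart := (Equiv.ofInjective γ hγ).trans
    ((Equiv.setCongr hS).trans (Equiv.ofInjective γ' hγ').symm)
  have hθ : ∀ t, γ' (θ t) = γ t := fun t => by
    have : Equiv.ofInjective γ' hγ' (θ t) = Equiv.setCongr hS (Equiv.ofInjective γ hγ t) := by
      simp [θ]
    exact congrArg Subtype.val this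
  refine ⟨θ, fun t => hγ' ?_, fun t => hγ' ?_, hγ' ?_, hθ⟩
  · have h1 := hF t
    have h2 := hF' (θ t)
    rw [hθ t, ← hS] at h2
    rw [hθ, h1.unique h2]
  · rw [hθ, hi, hi', hθ]
  · rw [← hS] at hr'
    rw [hθ, hr.unique hr']

/-! ### Numbering the edges of a contour -/

section Orbit

variable {X : Type*} [Finite X] (f : Perm X) (a : X)

theorem isCycleOn_orbit : f.IsCycleOn (Set.toFinite {x | f.SameCycle a x}).toFinset := by
  rw [Set.Finite.coe_toFinset]
  refine ⟨⟨fun x hx => ?_, f.injective.injOn, fun x hx => ?_⟩, fun x hx y hy => ?_⟩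
  · exact Perm.SameCycle.trans hx ⟨1, by simp⟩
  · exact ⟨f⁻¹ x, Perm.SameCycle.trans hx ⟨-1, by simp⟩, by simp⟩
  · exact Perm.SameCycle.trans (Perm.SameCycle.symm hx) hy

theorem pow_ncard_orbit : (f ^ {x | f.SameCycle a x}.ncard) a = a := by
  rw [Set.ncard_eq_toFinset_card _ (Set.toFinite _)]
  exact (isCycleOn_orbit f a).pow_card_apply (by simp [Perm.SameCycle.refl])

variable {f a}

theorem pow_orbit_injOn {i j : ℕ} (hi : i < {x | f.SameCycle a x}.ncard)
    (hj : j < {x | f.SameCycle a x}.ncard) (h : (f ^ i) a = (f ^ j) a) : i = j := by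
  rw [Set.ncard_eq_toFinset_card _ (Set.toFinite _)] at hi hj
  exact (((isCycleOn_orbit f a).pow_apply_eq_pow_apply (by simp [Perm.SameCycle.refl])).1
    h).eq_of_lt_of_lt hi hj

theorem exists_pow_orbit {x : X} (h : f.SameCycle a x) :
    ∃ i < {x | f.SameCycle a x}.ncard, (f ^ i) a = x := by
  rw [Set.ncard_eq_toFinset_card _ (Set.toFinite _)]
  exact (isCycleOn_orbit f a).exists_pow_eq (by simp [Perm.SameCycle.refl]) (by simpa using h)

end Orbit

namespace RotSys

variable {T B : RotSys} {n m : ℕ}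

/-- `β` places the reversed contour of `T` at the end of the contour of the external face
of `B`. -/
structure ReversedContour (n m : ℕ) (T B : RotSys) (β : T.Dart → B.Dart) : Prop where
  apply_pow : ∀ i < 2 * m, β ((T.face ^ i) T.root) = (B.face ^ (n + 2 * m - 1 - i)) B.root
  injective : Function.Injective β
  pow_notMem : ∀ i < n, (B.face ^ i) B.root ∉ Set.range β
  mem_boundary : ∀ t, β t ∈ B.boundary
  face_root : B.face (β T.root) = B.root
  face_apply : ∀ t, T.face t ≠ T.root → B.face (β (T.face t)) = β t

theorem ncard_orbit_of_tree (hT : ∀ t, T.face.SameCycle T.root t) :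
    {t | T.face.SameCycle T.root t}.ncard = Nat.card T.Dart := by
  rw [← Set.ncard_univ]
  congr
  exact Set.eq_univ_of_forall hT

theorem exists_pow_of_tree (hT : ∀ t, T.face.SameCycle T.root t) (hm : Nat.card T.Dart = 2 * m)
    (t : T.Dart) : ∃ i < 2 * m, (T.face ^ i) T.root = t := by
  have := exists_pow_orbit (hT t)
  rwa [ncard_orbit_of_tree hT, hm] at this

theorem exists_reversedContour (hT : ∀ t, T.face.SameCycle T.root t)
    (hm : Nat.card T.Dart = 2 * m) (hB : B.boundary.ncard = n + 2 * m) :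
    ∃ β, ReversedContour n m T B β := by
  choose idx hidx hidx' using exists_pow_of_tree hT hm
  have hcard := (ncard_orbit_of_tree hT).trans hm
  have hpos : 0 < 2 * m := by rw [← hm]; have : Nonempty T.Dart := ⟨T.root⟩; exact Nat.card_pos
  have hTN : (T.face ^ (2 * m)) T.root = T.root := by
    rw [← hcard]; exact pow_ncard_orbit _ _
  have hBN : (B.face ^ (n + 2 * m)) B.root = B.root := by
    rw [← hB]; exact pow_ncard_orbit _ _
  have hBinj : ∀ i < n + 2 * m, ∀ j < n + 2 * m,
      (B.face ^ i) B.root = (B.face ^ j) B.root → i = j := by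
    intro i hi j hj h
    rw [← hB] at hi hj
    exact pow_orbit_injOn hi hj h
  -- The contour of `T` fills the positions `n, …, n + 2 * m - 1` backwards, so that `β T.root`
  -- comes just before the root.
  let β : T.Dart → B.Dart := fun t => (B.face ^ (n + 2 * m - 1 - idx t)) B.root
  have h1 : ∀ i < 2 * m, β ((T.face ^ i) T.root) = (B.face ^ (n + 2 * m - 1 - i)) B.root := by
    intro i hi
    have : idx ((T.face ^ i) T.root) = i :=
      pow_orbit_injOn (by rw [hcard]; exact hidx _) (by rw [hcard]; exact hi) (hidx' _)
    simp only [β, this]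
  refine ⟨β, h1, fun t t' htt => ?_, ?_, fun t => ⟨(n + 2 * m - 1 - idx t : ℕ), by simp [β]⟩,
    ?_, ?_⟩
  · have h2 := hidx t
    have h3 := hidx t'
    have h4 := hBinj _ (by omega) _ (by omega) htt
    rw [← hidx' t, ← hidx' t']
    congr 2
    omega
  · rintro i hi ⟨t, ht⟩
    have h2 := hidx t
    have h4 := hBinj _ (by omega) _ (by omega) ht
    omega
  · have h2 := h1 0 hpos
    rw [pow_zero, Perm.one_apply] at h2
    rw [h2, ← Perm.mul_apply, ← pow_succ']
    convert hBN using 3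
    omega
  · intro t ht
    obtain ⟨i, hi, rfl⟩ := exists_pow_of_tree hT hm t
    rw [← Perm.mul_apply, ← pow_succ'] at ht
    have hi' : i + 1 < 2 * m := by
      rcases Nat.lt_or_ge (i + 1) (2 * m) with h | h
      · exact h
      · exact absurd (by rw [show i + 1 = 2 * m by omega, hTN]) ht
    have h2 := h1 _ hi'
    rw [pow_succ', Perm.mul_apply] at h2
    rw [h2, h1 _ hi, ← Perm.mul_apply, ← pow_succ']
    congr 2
    omega

end RotSys

namespace CutData

open RotSys

variable {T B M : RotSys} {ι : M.Dart → B.Dart} {β : T.Dart → B.Dart} {γ : T.Dart → M.Dart}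
  {n m : ℕ}

theorem pow_face_root (h : CutData T B M ι β γ) (hn : M.boundary.ncard = n) {i : ℕ} (hi : i < n) :
    (B.face ^ i) B.root = ι ((M.face ^ i) M.root) := by
  induction i with
  | zero => exact h.map_root.symm
  | succ i ih =>
    rw [pow_succ', pow_succ', Perm.mul_apply, Perm.mul_apply, ih (by omega), h.face_ι]
    rw [← Perm.mul_apply, ← pow_succ']
    intro hr
    have := pow_orbit_injOn (f := M.face) (a := M.root) (i := i + 1) (j := 0) (by rw [← hn] at hi; exact hi)
      (by rw [← hn] at hi; exact Nat.zero_lt_of_lt hi) hr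
    omega

theorem β_pow (h : CutData T B M ι β γ) (hT : ∀ t, T.face.SameCycle T.root t)
    (hm : Nat.card T.Dart = 2 * m) (hB : B.boundary.ncard = n + 2 * m) {i : ℕ} (hi : i < 2 * m) :
    β ((T.face ^ i) T.root) = (B.face ^ (n + 2 * m - 1 - i)) B.root := by
  have hcard := (ncard_orbit_of_tree hT).trans hm
  -- Counting the steps back to the root fixes the position, since the whole contour has length `n +
  -- 2 * m`.
  have key : (B.face ^ (i + 1)) (β ((T.face ^ i) T.root)) = B.root := by
    induction i with
    | zero => exact h.face_β_root
    | succ i ih =>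
      rw [pow_succ, Perm.mul_apply, pow_succ' T.face, Perm.mul_apply, h.face_β, ih (by omega)]
      rw [← Perm.mul_apply, ← pow_succ']
      intro hr
      have := pow_orbit_injOn (f := T.face) (a := T.root) (i := i + 1) (j := 0)
        (by rw [hcard]; exact hi) (by rw [hcard]; omega) hr
      omega
  apply (B.face ^ (i + 1)).injective
  rw [key, ← Perm.mul_apply, ← pow_add, show i + 1 + (n + 2 * m - 1 - i) = n + 2 * m by omega, ← hB]
  exact (pow_ncard_orbit _ _).symm

end CutData

/-! ### Gluing maps and cut data -/

namespace RootedMap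

theorem IsTree.sameCycle {T : RootedMap} (h : T.IsTree) (t : T.Dart) :
    T.toRotSys.face.SameCycle T.root t := by
  have : Subsingleton (Quotient (Perm.SameCycle.setoid T.face)) :=
    (Nat.card_eq_one_iff_unique.1 h).1
  exact Quotient.exact (Subsingleton.elim (Quotient.mk (Perm.SameCycle.setoid T.face) T.root)
    (Quotient.mk _ t))

theorem card_dart (T : RootedMap) : Nat.card T.Dart = 2 * T.numEdges :=
  (two_mul_numCycles T.inv_inv T.inv_ne).symm

theorem IsSimpleBoundary.toRotSys_simple {B : RootedMap} {f n : ℕ} (hB : B.IsSimpleBoundary f n) :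
    B.toRotSys.Simple := hB.simple

theorem IsSubmap.firstReturn {T M : RootedMap} {τ : T.Dart → M.Dart} (h : IsSubmap T M τ) :
    FirstReturn M.rot T.rot τ := firstReturn_iff.2 h.map_rot

section Glue

variable {n m f : ℕ} {T B M : RootedMap} {S : Set M.Dart} {π : B.Dart → M.Dart}
  {τ : T.Dart → M.Dart}

/-- Off the new edges `β t`, the identification `π` is injective and still surjective; `ι` is its
inverse there. -/
theorem GluingMap.exists_cutData (hG : GluingMap n m T B M S π τ) (hT : T.IsTree)
    (hm : T.numEdges = m) (hB : B.IsSimpleBoundary f (n + 2 * m)) (hn : 1 ≤ n) (hm1 : 1 ≤ m) :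
    ∃ ι β, CutData T.toRotSys B.toRotSys M.toRotSys ι β τ := by
  have hTs := hT.sameCycle
  have hTc : Nat.card T.toRotSys.Dart = 2 * m := hm ▸ T.card_dart
  have hBc : B.toRotSys.boundary.ncard = n + 2 * m := hB.ncard_boundary
  obtain ⟨β, hβ⟩ := RotSys.exists_reversedContour hTs hTc hBc
  have hex : ∀ t : T.Dart, ∃ i < 2 * m, (T.toRotSys.face ^ i) T.root = t :=
    RotSys.exists_pow_of_tree hTs hTc
  have hinv : ∀ t, B.inv (β t) ∉ B.toRotSys.boundary := fun t =>
    RotSys.Simple.inv_notMem hB.toRotSys_simple (by omega) (hβ.mem_boundary t)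
  have hinv' : ∀ t, B.inv (β t) ∉ Set.range β := by
    rintro t ⟨t', ht'⟩
    exact hinv t (ht' ▸ hβ.mem_boundary t')
  have hπc : ∀ t, π (B.inv (β t)) = τ t := by
    intro t
    obtain ⟨i, hi, rfl⟩ := hex t
    rw [hβ.apply_pow i hi]
    exact hG.map_contour i hi
  have hτi : ∀ t, τ (T.inv t) = M.inv (τ t) := hG.isSubmap.map_inv
  have hπβ : ∀ t, π (β t) = τ (T.inv t) := by
    intro t
    rw [hτi, ← hπc, hG.map_inv, M.inv_inv]
  have hι : ∀ x, ∃ y, y ∉ Set.range β ∧ π y = x := by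
    intro x
    obtain ⟨y, rfl⟩ := hG.surjective x
    by_cases hy : y ∈ Set.range β
    · obtain ⟨t, rfl⟩ := hy
      exact ⟨_, hinv' (T.inv t), by rw [hπc, hπβ]⟩
    · exact ⟨y, hy, rfl⟩
  -- In `glued`, one of the two identified edges is always some `β t`.
  have hπinj : ∀ y y', y ∉ Set.range β → y' ∉ Set.range β → π y = π y' → y = y' := by
    intro y y' hy hy' hyy
    by_contra hne
    obtain ⟨i, k, hi, hk, -, ⟨-, h⟩ | ⟨-, h⟩⟩ := hG.glued y y' hyy hne
    · exact hy' ⟨_, (hβ.apply_pow k hk).trans h.symm⟩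
    · exact hy ⟨_, (hβ.apply_pow k hk).trans h.symm⟩
  choose ι hιβ hπι using hι
  have hιπ : ∀ y, y ∉ Set.range β → ι (π y) = y := fun y hy =>
    hπinj _ _ (hιβ _) hy (hπι _)
  have hroot : B.root ∉ Set.range β := hβ.pow_notMem 0 hn
  -- The excluded edge is the last unglued boundary edge; `GluingMap` does not prescribe the
  -- successor of its image.
  have hfaceβ : ∀ y, y ∉ Set.range β → y ≠ (B.toRotSys.face ^ (n - 1)) B.root →
      B.toRotSys.face y ∉ Set.range β ∧ π (B.toRotSys.face y) = M.toRotSys.face (π y) := by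
    intro y hy hyn
    by_cases hyb : y ∈ B.toRotSys.boundary
    · obtain ⟨i, hi, rfl⟩ := exists_pow_orbit hyb
      change i < B.toRotSys.boundary.ncard at hi
      rw [hBc] at hi
      have hin : i < n := by
        by_contra hin
        refine hy ⟨_, (hβ.apply_pow (n + 2 * m - 1 - i) (by omega)).trans ?_⟩
        congr 2
        omega
      have hin' : i + 1 < n := by
        rcases Nat.lt_or_ge (i + 1) n with h | h
        · exact h
        · exact absurd (by rw [show i = n - 1 by omega]) hyn
      have h1 := hG.map_boundary i hin'
      have h2 := hβ.pow_notMem (i + 1) hin'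
      rw [pow_succ', Perm.mul_apply] at h1 h2
      exact ⟨h2, h1⟩
    · refine ⟨?_, hG.map_face y hyb⟩
      rintro ⟨t, ht⟩
      refine hyb (B.toRotSys.mem_boundary_of_face ?_)
      rw [← ht]
      exact hβ.mem_boundary t
  -- This successor is forced to be `M.root`: any other edge leading to `M.root` would lead to
  -- `B.root` in `B`, where the predecessor of the root is `β T.root`.
  have hlast : ∀ x, M.toRotSys.face x = M.root → ι x = (B.toRotSys.face ^ (n - 1)) B.root := by
    intro x hx
    by_contra hne
    obtain ⟨h1, h2⟩ := hfaceβ (ι x) (hιβ x) hne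
    rw [hπι, hx, ← hG.map_root] at h2
    have h3 := hπinj _ _ h1 hroot h2
    exact hιβ x ⟨T.root, B.toRotSys.face.injective (hβ.face_root.trans h3.symm)⟩
  refine ⟨ι, β, fun x x' hxx => by rw [← hπι x, hxx, hπι], hβ.injective,
    fun x t hxt => hιβ x ⟨t, hxt.symm⟩, ?_, ?_, ?_, ?_, hβ.face_root, hβ.face_apply, ?_, ?_, hτi⟩
  · intro y
    by_cases hy : y ∈ Set.range β
    · exact Or.inr hy
    · exact Or.inl ⟨_, hιπ y hy⟩
  · change ι M.root = B.root
    rw [← hG.map_root, hιπ _ hroot]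
  · intro x hx
    have hne : ι x ≠ (B.toRotSys.face ^ (n - 1)) B.root := by
      intro hne
      have h1 : M.toRotSys.face⁻¹ M.root = x := by
        rw [← hπι (M.toRotSys.face⁻¹ M.root), hlast _ (by simp), ← hne, hπι]
      exact hx (by rw [← h1]; simp)
    obtain ⟨h1, h2⟩ := hfaceβ (ι x) (hιβ x) hne
    rw [hπι] at h2
    rw [← h2, hιπ _ h1]
  · intro x hx
    have h1 : β ((T.toRotSys.face ^ (2 * m - 1)) T.root) = (B.toRotSys.face ^ n) B.root := by
      refine (hβ.apply_pow (2 * m - 1) (by omega)).trans ?_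
      congr 2
      omega
    have h2 : (T.toRotSys.face ^ (2 * m - 1)) T.root = T.toRotSys.face⁻¹ T.root := by
      rw [Perm.eq_inv_iff_eq, ← Perm.mul_apply, ← pow_succ', show 2 * m - 1 + 1 = 2 * m by omega,
        ← hTc, ← RotSys.ncard_orbit_of_tree hTs]
      exact pow_ncard_orbit _ _
    change _ = β (T.toRotSys.face⁻¹ T.root)
    rw [← h2, h1, hlast x hx, ← Perm.mul_apply, ← pow_succ', show n - 1 + 1 = n by omega]
  · intro t
    change B.inv (β t) = ι (τ t)
    rw [← hπc, hιπ _ (hinv' t)]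
  · intro x hx
    change B.inv (ι x) = ι (M.inv x)
    rw [← hιπ (B.inv (ι x)), hG.map_inv, hπι]
    rintro ⟨t, ht⟩
    refine hx ⟨t, ?_⟩
    rw [← hπc, ht, B.inv_inv, hπι]

theorem exists_gluingMap {ι : M.Dart → B.Dart} {β : T.Dart → B.Dart} {γ : T.Dart → M.Dart}
    (h : CutData T.toRotSys B.toRotSys M.toRotSys ι β γ) (hS : IsSubmap T M γ) (hT : T.IsTree)
    (hm : T.numEdges = m) (hM : M.boundary.ncard = n) :
    ∃ π, GluingMap n m T B M (Set.range γ) π γ := by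
  have hTs := hT.sameCycle
  have hTc : Nat.card T.toRotSys.Dart = 2 * m := hm ▸ T.card_dart
  have hMc : M.toRotSys.boundary.ncard = n := hM
  have hBc : B.toRotSys.boundary.ncard = n + 2 * m := by
    rw [h.ncard_boundary hTs, hMc, two_mul_numCycles T.inv_inv T.inv_ne, ← hTc]
  have hβ : ∀ i < 2 * m, β ((T.face ^ i) T.root) = (B.face ^ (n + 2 * m - 1 - i)) B.root :=
    fun i hi => h.β_pow hTs hTc hBc hi
  have hex : ∀ t : T.Dart, ∃ i < 2 * m, (T.face ^ i) T.root = t :=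
    RotSys.exists_pow_of_tree hTs hTc
  have hbd : ∀ i < n, (B.face ^ i) B.root = ι ((M.face ^ i) M.root) :=
    fun i hi => h.pow_face_root hMc hi
  let E := Equiv.ofBijective _ h.sum_bijective
  -- As the opposite of `ι (γ t)`, the edge `β t` has to become the opposite of `γ t`, which is `γ
  -- (T.inv t)`.
  let π : B.Dart → M.Dart := fun y => Sum.elim id (fun t => γ (T.inv t)) (E.symm y)
  have hπι : ∀ x, π (ι x) = x := by
    intro x
    have : E.symm (ι x) = Sum.inl x := by rw [Equiv.symm_apply_eq]; rfl
    simp [π, this]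
  have hπβ : ∀ t, π (β t) = γ (T.inv t) := by
    intro t
    have : E.symm (β t) = Sum.inr t := by rw [Equiv.symm_apply_eq]; rfl
    simp [π, this]
  have hβi : ∀ t, B.inv (β t) = ι (γ t) := h.inv_β
  have hγi : ∀ t, γ (T.inv t) = M.inv (γ t) := h.map_inv
  refine ⟨π, fun x => ⟨_, hπι x⟩, ?_, ?_, ?_, ?_, hS, rfl, ?_, ?_⟩
  · intro y
    rcases h.cover y with ⟨x, rfl⟩ | ⟨t, rfl⟩
    · by_cases hx : x ∈ Set.range γ
      · obtain ⟨t, rfl⟩ := hx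
        rw [hπι, ← hβi, B.inv_inv, hπβ, hγi]
      · rw [hπι, show B.inv (ι x) = ι (M.inv x) from h.inv_ι x hx, hπι]
    · rw [hβi, hπι, hπβ, hγi, M.inv_inv]
  · rw [← show ι M.root = B.root from h.map_root, hπι]
  · intro y hy
    rcases h.cover y with ⟨x, rfl⟩ | ⟨t, rfl⟩
    · have hx : M.toRotSys.face x ≠ M.root := by
        intro hx
        refine hy ((h.ι_mem_boundary hTs).2 (M.toRotSys.mem_boundary_of_face ?_))
        rw [hx]
        exact M.toRotSys.root_mem_boundary
      rw [hπι]
      exact (congrArg π (h.face_ι x hx)).trans (hπι _)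
    · exact absurd (h.β_mem_boundary hTs t) hy
  · intro i hi
    rw [hbd _ hi, hbd _ (by omega), hπι, hπι, pow_succ', Perm.mul_apply]
  · intro i hi
    rw [← hβ i hi, hβi, hπι]
  · have key : ∀ x t, x = γ (T.inv t) → ∃ i k : ℕ, i < 2 * m ∧ k < 2 * m ∧
        (T.face ^ k) T.root = T.inv ((T.face ^ i) T.root) ∧
        ι x = B.inv ((B.face ^ (n + 2 * m - 1 - i)) B.root) ∧
        β t = (B.face ^ (n + 2 * m - 1 - k)) B.root := by
      rintro _ t rfl
      obtain ⟨k, hk, hkt⟩ := hex t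
      obtain ⟨i, hi, hit⟩ := hex (T.inv t)
      refine ⟨i, k, hi, hk, by rw [hkt, hit, T.inv_inv], ?_, ?_⟩
      · rw [← hβ i hi, hit, hβi]
      · rw [← hβ k hk, hkt]
    intro y y' hyy hne
    rcases h.cover y with ⟨x, rfl⟩ | ⟨t, rfl⟩ <;> rcases h.cover y' with ⟨x', rfl⟩ | ⟨t', rfl⟩
    · rw [hπι, hπι] at hyy
      exact absurd (congrArg ι hyy) hne
    · rw [hπι, hπβ] at hyy
      obtain ⟨i, k, hi, hk, h1, h2, h3⟩ := key x t' hyy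
      exact ⟨i, k, hi, hk, h1, Or.inl ⟨h2, h3⟩⟩
    · rw [hπι, hπβ] at hyy
      obtain ⟨i, k, hi, hk, h1, h2, h3⟩ := key x' t hyy.symm
      exact ⟨i, k, hi, hk, h1, Or.inr ⟨h2, h3⟩⟩
    · rw [hπβ, hπβ] at hyy
      exact absurd (congrArg β (T.inv.injective (h.γ_injective hyy))) hne

end Glue

end RootedMap

/-! ### Invariance under isomorphisms -/

namespace RootedMap

namespace Iso

variable {M N : RootedMap} (e : Iso M N)

theorem map_face (d : M.Dart) : e.toEquiv (M.face d) = N.face (e.toEquiv d) := by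
  rw [face, face, Perm.mul_apply, Perm.mul_apply, e.map_rot, e.map_inv]

theorem map_pow_of_map {X Y : Type*} {σ : Perm X} {σ' : Perm Y} {e : X ≃ Y}
    (h : ∀ d, e (σ d) = σ' (e d)) (k : ℕ) (d : X) : e ((σ ^ k) d) = (σ' ^ k) (e d) := by
  induction k with
  | zero => rfl
  | succ k ih => rw [pow_succ', pow_succ', Perm.mul_apply, Perm.mul_apply, h, ih]

theorem map_face_pow_root (k : ℕ) : e.toEquiv ((M.face ^ k) M.root) = (N.face ^ k) N.root := by
  rw [map_pow_of_map e.map_face, e.map_root]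

theorem map_mem_boundary {d : M.Dart} (hd : d ∈ M.boundary) : e.toEquiv d ∈ N.boundary := by
  obtain ⟨k, rfl⟩ := Perm.SameCycle.exists_nat_pow_eq hd
  rw [e.map_face_pow_root]
  exact ⟨k, by simp⟩

end Iso

theorem IsSubmap.map_iso {T T' M M' : RootedMap} {τ : T.Dart → M.Dart} (h : IsSubmap T M τ)
    (eT : Iso T T') (eM : Iso M M') :
    IsSubmap T' M' (fun t => eM.toEquiv (τ (eT.symm.toEquiv t))) where
  injective := eM.toEquiv.injective.comp (h.injective.comp eT.symm.toEquiv.injective)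
  map_inv d := by rw [eT.symm.map_inv, h.map_inv, eM.map_inv]
  map_rot d := by
    obtain ⟨k, hk, h1, h2⟩ := h.map_rot (eT.symm.toEquiv d)
    refine ⟨k, hk, ?_, fun j hj hjk => ?_⟩
    · rw [← Iso.map_pow_of_map eM.map_rot, h1, eT.symm.map_rot]
    · rw [← Iso.map_pow_of_map eM.map_rot]
      rintro ⟨t, ht⟩
      exact h2 j hj hjk ⟨_, eM.toEquiv.injective ht⟩

theorem GluingMap.map_iso {n m : ℕ} {T T' B B' M M' : RootedMap} {S : Set M.Dart}
    {π : B.Dart → M.Dart} {τ : T.Dart → M.Dart} (h : GluingMap n m T B M S π τ)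
    (eT : Iso T T') (eB : Iso B B') (eM : Iso M M') :
    GluingMap n m T' B' M' (eM.toEquiv '' S) (fun d => eM.toEquiv (π (eB.symm.toEquiv d)))
      (fun t => eM.toEquiv (τ (eT.symm.toEquiv t))) where
  surjective := eM.toEquiv.surjective.comp (h.surjective.comp eB.symm.toEquiv.surjective)
  map_inv d := by rw [eB.symm.map_inv, h.map_inv, eM.map_inv]
  map_root := by rw [eB.symm.map_root, h.map_root, eM.map_root]
  map_face d hd := by
    rw [eB.symm.map_face, h.map_face, eM.map_face]
    intro hd'
    have := eB.map_mem_boundary hd'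
    rw [Iso.symm, Equiv.apply_symm_apply] at this
    exact hd this
  map_boundary i hi := by
    rw [eB.symm.map_face_pow_root, eB.symm.map_face_pow_root, h.map_boundary i hi, eM.map_face]
  isSubmap := h.isSubmap.map_iso eT eM
  range_eq := by
    rw [← h.range_eq, ← Set.range_comp]
    exact eT.symm.toEquiv.surjective.range_comp (eM.toEquiv ∘ τ)
  map_contour i hi := by
    rw [eB.symm.map_inv, eB.symm.map_face_pow_root, eT.symm.map_face_pow_root, h.map_contour i hi]
  glued d d' hd hne := by
    obtain ⟨i, k, hi, hk, h1, h2⟩ := h.glued _ _ (eM.toEquiv.injective hd)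
      (fun hn => hne (eB.symm.toEquiv.injective hn))
    refine ⟨i, k, hi, hk, ?_, ?_⟩
    · rw [← eT.map_face_pow_root, h1, eT.map_inv, eT.map_face_pow_root]
    · have hd : ∀ d, eB.symm.toEquiv d = B.inv ((B.face ^ (n + 2 * m - 1 - i)) B.root) →
          d = B'.inv ((B'.face ^ (n + 2 * m - 1 - i)) B'.root) := by
        intro d hd
        rw [← eB.map_face_pow_root, ← eB.map_inv, ← hd, Iso.symm, Equiv.apply_symm_apply]
      have hd' : ∀ d, eB.symm.toEquiv d = (B.face ^ (n + 2 * m - 1 - k)) B.root →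
          d = (B'.face ^ (n + 2 * m - 1 - k)) B'.root := by
        intro d hd
        rw [← eB.map_face_pow_root, ← hd, Iso.symm, Equiv.apply_symm_apply]
      exact h2.imp (fun h => ⟨hd _ h.1, hd' _ h.2⟩) fun h => ⟨hd _ h.1, hd' _ h.2⟩

end RootedMap

/-! ### The bijection -/

section Gluing

variable {f n m : ℕ}

theorem IsGluing.congr {T T' : PlaneTreeRep m} {B B' : SimpleBoundaryMapRep f (n + 2 * m)}
    {X X' : DecoratedMapRep f n m} (h : IsGluing T B X) (hT : T ≈ T') (hB : B ≈ B')
    (hX : X ≈ X') : IsGluing T' B' X' := by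
  obtain ⟨π, τ, h⟩ := h
  obtain ⟨eT⟩ := hT
  obtain ⟨eB⟩ := hB
  obtain ⟨eX, hS⟩ := hX
  have hS' : eX.toEquiv '' X.tree = X'.tree := by
    ext d
    constructor
    · rintro ⟨d, hd, rfl⟩
      exact (hS d).2 hd
    · intro hd
      obtain ⟨d, rfl⟩ := eX.toEquiv.surjective d
      exact ⟨d, (hS d).1 hd, rfl⟩
  exact ⟨_, _, hS' ▸ h.map_iso eT eB eX⟩

theorem exists_isGluing_right (hn : 1 ≤ n) (hm : 1 ≤ m) (T : PlaneTreeRep m)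
    (B : SimpleBoundaryMapRep f (n + 2 * m)) : ∃ X : DecoratedMapRep f n m, IsGluing T B X := by
  obtain ⟨T, hT, hTm⟩ := T
  obtain ⟨B, hB⟩ := B
  have hTs := hT.sameCycle
  have hTc : Nat.card T.toRotSys.Dart = 2 * m := hTm ▸ T.card_dart
  have hBc : B.toRotSys.boundary.ncard = n + 2 * m := hB.ncard_boundary
  have hBs : B.toRotSys.Simple := hB.simple
  obtain ⟨β, hβ⟩ := RotSys.exists_reversedContour hTs hTc hBc
  have hinv : ∀ t, B.toRotSys.inv (β t) ∉ B.toRotSys.boundary := fun t =>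
    hBs.inv_notMem (by omega) (hβ.mem_boundary t)
  obtain ⟨M, ι, γ, h⟩ := exists_glued hTs hβ.injective (hβ.pow_notMem 0 hn)
    (fun t ⟨t', ht'⟩ => hinv t (ht' ▸ hβ.mem_boundary t')) hβ.face_root hβ.face_apply
  -- Otherwise `γ t` would be on the boundary of `M`, and both `β t` and its opposite on that of
  -- `B`.
  have hγ : ∀ t, M.face (γ t) ≠ M.root := by
    intro t ht
    refine hinv t ?_
    rw [h.inv_β, h.ι_mem_boundary hTs]
    refine M.mem_boundary_of_face ?_
    rw [ht]
    exact M.root_mem_boundary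
  have hF := h.firstReturn_of_simple hTs hγ hBs
  have hMc := h.connected_glued hγ hF (RotSys.connected_toRotSys T) (RotSys.connected_toRotSys B)
  have hMp := (h.planar_iff hγ hF hTs T.planar hT).1 B.planar
  let N := M.toRootedMap hMc hMp
  have hSub : RootedMap.IsSubmap T N γ :=
    ⟨h.γ_injective, h.map_inv, firstReturn_iff.1 (h.firstReturn_γ hγ hF)⟩
  have hNb : N.boundary.ncard = n := by
    have h1 := h.ncard_boundary hTs
    rw [hBc, two_mul_numCycles T.inv_inv T.inv_ne] at h1
    change M.boundary.ncard = n
    have h2 : Nat.card T.Dart = 2 * m := hTc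
    omega
  obtain ⟨π, hπ⟩ := RootedMap.exists_gluingMap (M := N) h hSub hT hTm hNb
  exact ⟨⟨N, Set.range γ, ⟨(h.numCycles_face hTs).symm.trans hB.numFaces_eq, hNb,
      h.simple_glued hTs hγ hBs⟩,
    ⟨⟨T, γ, hT, hTm, hSub, rfl⟩, ⟨_, ⟨T.root, rfl⟩, (CutData.hits_root hF).sameCycle.symm⟩, by
      rintro _ ⟨t, rfl⟩ b hb hs
      rwa [h.eq_root_of_sameCycle_corner hTs hγ hBs (o := some t) hb (Perm.SameCycle.symm hs)]
        at hs⟩⟩, π, γ, hπ⟩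

/-- A subtree that meets the boundary only at the root vertex contains no edge of the boundary. -/
theorem face_ne_root_of_subtree {T M : RotSys} {γ : T.Dart → M.Dart}
    (hγ : Function.Injective γ) (hinv : ∀ t, γ (T.inv t) = M.inv (γ t))
    (hF : FirstReturn M.rot T.rot γ) (hT : ∀ t, T.face.SameCycle T.root t)
    (hr : ∀ t, ∀ b ∈ M.boundary, M.rot.SameCycle (γ t) b → b = M.root) (t : T.Dart) :
    M.face (γ t) ≠ M.root := by
  intro ht
  have h1 : γ t ∈ M.boundary := M.mem_boundary_of_face (ht ▸ M.root_mem_boundary)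
  have h2 : γ t = M.root := hr t _ h1 (Perm.SameCycle.refl _ _)
  -- In `M`, the edge `γ t = M.root` follows itself on its contour, hence `t` does so in `T`. As `T`
  -- has a single face, `t` would be its only oriented edge.
  have h3 : T.face t = t := by
    have h4 := hF (T.inv t)
    rw [hinv, ← M.face_apply, ht, ← h2] at h4
    exact (hγ (h4.eq_of_mem ⟨t, rfl⟩)).symm
  have h5 : ∀ s, s = t := by
    intro s
    obtain ⟨k, rfl⟩ := ((hT t).symm.trans (hT s)).exists_nat_pow_eq
    clear hr
    induction k with
    | zero => rfl
    | succ k ih => rw [pow_succ', Perm.mul_apply, ih, h3]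
  exact T.inv_ne t (h5 _)

theorem exists_isGluing_left (X : DecoratedMapRep f n m) :
    ∃ (T : PlaneTreeRep m) (B : SimpleBoundaryMapRep f (n + 2 * m)), IsGluing T B X := by
  obtain ⟨M, S, hM, ⟨T₀, γ, hT₀, hTm, hSub, rfl⟩, ⟨d₀, hd₀, hd₀r⟩, honly⟩ := X
  -- The tree is planted anew at its first edge clockwise from `M.root`, as required by
  -- `firstReturn_corner`.
  obtain ⟨_, hz⟩ := Hits.exists_of_sameCycle (Perm.SameCycle.symm hd₀r) hd₀
  obtain ⟨t₀, rfl⟩ := hz.mem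
  let T : RootedMap := { T₀ with root := t₀ }
  have hT : T.IsTree := hT₀
  have hSubT : RootedMap.IsSubmap T M γ := ⟨hSub.injective, hSub.map_inv, hSub.map_rot⟩
  have hTs := hT.sameCycle
  have hr : ∀ t, ∀ b ∈ M.toRotSys.boundary, M.toRotSys.rot.SameCycle (γ t) b →
      b = M.toRotSys.root := by
    intro t b hb hs
    refine hM.simple b hb _ M.toRotSys.root_mem_boundary ?_
    exact Perm.SameCycle.trans (Perm.SameCycle.symm hs) (honly _ ⟨t, rfl⟩ b hb hs)
  have hF₀ : FirstReturn M.toRotSys.rot T.toRotSys.rot γ := hSubT.firstReturn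
  have hγ := face_ne_root_of_subtree (T := T.toRotSys) (M := M.toRotSys) hSubT.injective
    hSubT.map_inv hF₀ hTs hr
  obtain ⟨B, ι, β, h⟩ := exists_cut (T := T.toRotSys) (M := M.toRotSys) (γ := γ) hSubT.injective
    hSubT.map_inv
  have hF := h.firstReturn_corner hγ hF₀ hz
  have hBs := h.simple_cut hTs hγ hF hM.simple hr
  have hBc := h.connected_cut hTs (RotSys.connected_toRotSys M)
  have hBp := (h.planar_iff hγ hF hTs T.planar hT).2 M.planar
  have hBb : B.boundary.ncard = n + 2 * m := by
    rw [h.ncard_boundary hTs]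
    exact congrArg₂ (fun a b => a + 2 * b) hM.ncard_boundary hTm
  obtain ⟨π, hπ⟩ := RootedMap.exists_gluingMap (B := B.toRootedMap hBc hBp) h hSubT hT hTm
    hM.ncard_boundary
  exact ⟨⟨T, hT, hTm⟩, ⟨B.toRootedMap hBc hBp,
    (h.numCycles_face hTs).trans hM.numFaces_eq, hBb, hBs⟩, π, γ, hπ⟩

theorem isGluing_right_unique (hn : 1 ≤ n) (hm : 1 ≤ m) {T : PlaneTreeRep m}
    {B : SimpleBoundaryMapRep f (n + 2 * m)} {X X' : DecoratedMapRep f n m}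
    (h : IsGluing T B X) (h' : IsGluing T B X') : X ≈ X' := by
  obtain ⟨π, τ, h⟩ := h
  obtain ⟨π', τ', h'⟩ := h'
  obtain ⟨ι, β, hC⟩ := h.exists_cutData T.2.1 T.2.2 B.2 hn hm
  obtain ⟨ι', β', hC'⟩ := h'.exists_cutData T.2.1 T.2.2 B.2 hn hm
  obtain ⟨e, h1, h2, h3, h4⟩ := hC.glued_unique hC' T.2.1.sameCycle
  refine ⟨⟨e, h1, h2, h3⟩, fun d => ?_⟩
  rw [← h.range_eq, ← h'.range_eq]
  constructor
  · rintro ⟨t, ht⟩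
    exact ⟨t, e.injective ((h4 t).trans ht)⟩
  · rintro ⟨t, rfl⟩
    exact ⟨t, (h4 t).symm⟩

/-- By `hits_root`, every gluing has the root of the tree at the first edge of the tree after the
root of `X`. So `X` determines the planted tree, and cutting along it determines `B`. -/
theorem isGluing_left_unique (hn : 1 ≤ n) (hm : 1 ≤ m) {T T' : PlaneTreeRep m}
    {B B' : SimpleBoundaryMapRep f (n + 2 * m)} {X : DecoratedMapRep f n m}
    (h : IsGluing T B X) (h' : IsGluing T' B' X) : T ≈ T' ∧ B ≈ B' := by
  have key : ∀ {T : PlaneTreeRep m} {B : SimpleBoundaryMapRep f (n + 2 * m)}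
      {π : B.1.Dart → X.map.Dart} {τ : T.1.Dart → X.map.Dart},
      RootedMap.GluingMap n m T.1 B.1 X.map X.tree π τ → ∃ ι β,
      CutData T.1.toRotSys B.1.toRotSys X.map.toRotSys ι β τ ∧
        Hits X.map.rot (Set.range τ) X.map.root (τ T.1.root) := by
    intro T B π τ h
    obtain ⟨ι, β, hC⟩ := h.exists_cutData T.2.1 T.2.2 B.2 hn hm
    have hTs := T.2.1.sameCycle
    have hBs : B.1.toRotSys.Simple := B.2.simple
    have hBc : B.1.toRotSys.boundary.ncard = n + 2 * m := B.2.ncard_boundary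
    have hγ : ∀ t, X.map.toRotSys.face (τ t) ≠ X.map.toRotSys.root := by
      intro t ht
      refine hBs.inv_notMem (by omega) (hC.β_mem_boundary hTs t) ?_
      rw [hC.inv_β, hC.ι_mem_boundary hTs]
      refine X.map.toRotSys.mem_boundary_of_face ?_
      rw [ht]
      exact X.map.toRotSys.root_mem_boundary
    have hH := CutData.hits_root (hC.firstReturn_of_simple hTs hγ hBs)
    refine ⟨ι, β, hC, hH.trans_subset ?_ (Hits.here ⟨_, rfl⟩)⟩
    rintro _ ⟨t, rfl⟩
    exact ⟨some t, rfl⟩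
  obtain ⟨π, τ, h⟩ := h
  obtain ⟨π', τ', h'⟩ := h'
  obtain ⟨ι, β, hC, hH⟩ := key h
  obtain ⟨ι', β', hC', hH'⟩ := key h'
  obtain ⟨θ, h1, h2, h3, h4⟩ := subtree_unique (T := T.1.toRotSys) (T' := T'.1.toRotSys)
    (M := X.map.toRotSys) h.isSubmap.injective h'.isSubmap.injective h.isSubmap.map_inv
    h'.isSubmap.map_inv h.isSubmap.firstReturn h'.isSubmap.firstReturn
    (h.range_eq.trans h'.range_eq.symm) hH hH'
  obtain ⟨e, h5, h6, h7⟩ := hC.cut_unique hC' θ h1 h2 h3 h4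
  exact ⟨⟨⟨θ, h1, h2, h3⟩⟩, ⟨⟨e, h5, h6, h7⟩⟩⟩

end Gluing

theorem mainTheorem7 (f m₁ m₂ : ℕ) (h₁ : 1 ≤ m₁) (h₂ : 1 ≤ m₂) :
    ∃ Ψ : PlaneTree m₂ × SimpleBoundaryMap f (m₁ + 2 * m₂) ≃ DecoratedMap f m₁ m₂,
      ∀ (T : PlaneTreeRep m₂) (B : SimpleBoundaryMapRep f (m₁ + 2 * m₂))
        (X : DecoratedMapRep f m₁ m₂),
        Ψ (Quotient.mk _ T, Quotient.mk _ B) = Quotient.mk _ X ↔ IsGluing T B X := by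
  choose F hF using exists_isGluing_right (f := f) h₁ h₂
  let Ψ : PlaneTree m₂ × SimpleBoundaryMap f (m₁ + 2 * m₂) → DecoratedMap f m₁ m₂ :=
    -- The choice of representatives is immaterial, by `IsGluing.congr` and `isGluing_right_unique`.
    fun p => Quotient.mk _ (F p.1.out p.2.out)
  have hΨ : ∀ (T : PlaneTreeRep m₂) (B : SimpleBoundaryMapRep f (m₁ + 2 * m₂))
      (X : DecoratedMapRep f m₁ m₂),
      Ψ (Quotient.mk _ T, Quotient.mk _ B) = Quotient.mk _ X ↔ IsGluing T B X := by
    intro T B X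
    have hG := (hF (Quotient.mk _ T).out (Quotient.mk _ B).out).congr
      (Quotient.mk_out T) (Quotient.mk_out B) (Setoid.refl _)
    constructor
    · intro hX
      exact hG.congr (Setoid.refl _) (Setoid.refl _) (Quotient.exact hX)
    · intro hX
      exact Quotient.sound (isGluing_right_unique h₁ h₂ hG hX)
  have hbij : Function.Bijective Ψ := by
    constructor
    · rintro ⟨⟨T⟩, ⟨B⟩⟩ ⟨⟨T'⟩, ⟨B'⟩⟩ hp
      obtain ⟨X, hX⟩ := Quotient.mk_surjective (Ψ (Quotient.mk _ T', Quotient.mk _ B'))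
      obtain ⟨hT, hB⟩ := isGluing_left_unique h₁ h₂ ((hΨ T B X).1 (hp.trans hX.symm))
        ((hΨ T' B' X).1 hX.symm)
      exact Prod.ext (Quotient.sound hT) (Quotient.sound hB)
    · rintro ⟨X⟩
      obtain ⟨T, B, h⟩ := exists_isGluing_left X
      exact ⟨(Quotient.mk _ T, Quotient.mk _ B), (hΨ T B X).2 h⟩
  exact ⟨Equiv.ofBijective Ψ hbij, hΨ⟩
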